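/- \textbf{Setting.} Let $\Omega\subseteq\mathbb R^3$ be open, with coordinates $(x,\tau,t)$, and let $\mathcal A$ be an algebra of smooth functions $\Omega\to\mathbb C$ that contains the constants and is closed under $D=\partial_x$, $\partial_\tau$, $\partial_t$. Let $J\subseteq\mathcal A$ be an ideal closed under $\partial_\tau,\partial_t$ and such that $D$ maps $J$ bijectively onto $J$; $D^{-1}\{f\}\in J$ denotes the inverse image of $f\in J$ (for example, $J$ consists of functions that decay rapidly with all derivatives as $x\to-\infty$, and $D^{-1}\{f\}=\int_{-\infty}^x f$). Operators act on matrix functions (with $N$ rows and any number of columns) with entries in $J$; $X\{f\}$ is the action of $X$ on $f$, and $X^{\tau}$ is the formal transpose, determined by $(uD^j)^\tau=(-1)^jD^ju^{\top}$, $(gD^{-1}h^{\top})^\tau=-hD^{-1}g^{\top}$, $\partial_\tau^\tau=-\partial_\tau$, $\partial_t^\tau=-\partial_t$, $(XY)^\tau=Y^\tau X^\tau$. Let $k,n,l\in\mathbb N_0$, $\alpha,\beta,c\in\mathbb C$, $u_j,v_i\in \mathrm{Mat}_{N\times N}(\mathcal A)$, $\mathbf q,\mathbf r\in \mathrm{Mat}_{N\times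 m}(J)$, $\mathcal M_0\in \mathrm{Mat}_{m\times m}(\mathbb C)$ and $$L=\beta\partial_\tau-\sum_{j=0}^k u_jD^j-\mathbf q\mathcal M_0D^{-1}\mathbf r^{\top},\qquad M=\alpha\partial_t-\sum_{i=0}^n v_iD^i-c\sum_{j=0}^l \mathbf q[j]\mathcal M_0D^{-1}\mathbf r^{\top}[l-j],\qquad \tilde M=M-cL^{l+1},$$ where $\mathbf q[j]=L^j\{\mathbf q\}$, $\mathbf r[j]=(L^\tau)^j\{\mathbf r\}$. Let $\varphi,\psi\in \mathrm{Mat}_{N\times K}(J)$ and $\Lambda,\tilde\Lambda\in \mathrm{Mat}_{K\times K}(\mathbb C)$ satisfy $$L\{\varphi\}=\varphi\Lambda,\quad L^\tau\{\psi\}=\psi\tilde\Lambda,\quad M\{\varphi\}=c\,\varphi\Lambda^{l+1},\quad M^\tau\{\psi\}=c\,\psi\tilde\Lambda^{l+1}.$$ Let $C\in \mathrm{GL}_K(\mathbb C)$, assume that $\Delta=C+D^{-1}\{\psi^{\top}\varphi\}$ is invertible in $\mathrm{Mat}_{K\times K}(\mathcal A)$, and put $$W=I-\varphi\Delta^{-1}D^{-1}\psi^{\top},\qquad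 W^{-1}=I+\varphi D^{-1}\Delta^{-1}\psi^{\top},$$ $$\Phi=W\{\varphi\}C^{-1},\quad \Psi=W^{-1,\tau}\{\psi\}C^{\top,-1},\quad \hat{\mathbf q}=W\{\mathbf q\},\quad \hat{\mathbf r}=W^{-1,\tau}\{\mathbf r\},\quad \mathcal M_1=C\Lambda-\tilde\Lambda^{\top}C,$$ $$\hat L=WLW^{-1},\qquad \hat M=WMW^{-1},\qquad \hat{\tilde M}=W\tilde MW^{-1}.$$ \textbf{Claim.} $W$ and $W^{-1}$ are mutually inverse, and so are $W^{\tau}$ and $W^{-1,\tau}$; $\Phi=\varphi\Delta^{-1}$ and $\Psi=\psi\Delta^{-1,\top}$ have entries in $J$; there are $\hat u_j,\hat v_i\in \mathrm{Mat}_{N\times N}(\mathcal A)$ such that $$\hat L=\beta\partial_\tau-\sum_{j=0}^k\hat u_jD^j-\hat{\mathbf q}\mathcal M_0D^{-1}\hat{\mathbf r}^{\top}+\Phi\mathcal M_1D^{-1}\Psi^{\top},$$ $$\hat M=\alpha\partial_t-\sum_{i=0}^n\hat v_iD^i-c\sum_{j=0}^l\hat{\mathbf q}[j]\mathcal M_0D^{-1}\hat{\mathbf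 r}^{\top}[l-j]+c\sum_{s=0}^l\Phi[s]\mathcal M_1D^{-1}\Psi^{\top}[l-s],$$ where now $[j]$ denotes $\hat L^j$ applied to $\hat{\mathbf q},\Phi$ and $(\hat L^\tau)^j$ applied to $\hat{\mathbf r},\Psi$; the transposes $\hat L^\tau=W^{-1,\tau}L^\tau W^\tau$ and $\hat M^\tau=W^{-1,\tau}M^\tau W^\tau$ are given by the formal transposes of these expressions, with the same $\hat u_j,\hat v_i$; $\hat{\tilde M}=\hat M-c\hat L^{l+1}$, $\hat{\tilde M}^\tau=\hat M^\tau-c(\hat L^\tau)^{l+1}$; and $$\hat{\tilde M}\{\Phi\}=\hat M\{\Phi\}-c\hat L^{l+1}\{\Phi\}=0,\qquad \hat{\tilde M}^\tau\{\Psi\}=\hat M^\tau\{\Psi\}-c(\hat L^\tau)^{l+1}\{\Psi\}=0.$$ If moreover $[L,M]=0$, then $[\hat L,\hat{\tilde M}]=0$. All equalities of operators are equalities of their actions on matrix functions with entries in $J$. -/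

import Mathlib

open scoped ContDiff

noncomputable section

namespace BDKP

/-- The space of the independent variables `(x, τ_k, t_n)`. -/
abbrev Vars : Type := ℝ × ℝ × ℝ

def dirX : Vars := (1, 0, 0)
def dirTau : Vars := (0, 1, 0)
def dirT : Vars := (0, 0, 1)

/-- Extension by zero of a function on the open set `Ω`. It is only evaluated and differentiated at
points of `Ω`. -/
def extendZero (Ω : TopologicalSpace.Opens Vars) (f : Ω → ℂ) : Vars → ℂ :=
  Function.extend (Subtype.val : Ω → Vars) f 0

/-- The partial derivative in the direction `e` of a function on the open set `Ω`. -/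
def partialDeriv (Ω : TopologicalSpace.Opens Vars) (e : Vars) (f : Ω → ℂ) : Ω → ℂ :=
  fun p => lineDeriv ℝ (extendZero Ω f) (p : Vars) e

/-- An algebra of smooth complex functions on `Ω`, containing the constants and closed under the
three partial derivatives. -/
structure FunAlg (Ω : TopologicalSpace.Opens Vars) where
  carrier : Subalgebra ℂ (Ω → ℂ)
  smooth : ∀ f ∈ carrier, ContDiffOn ℝ ∞ (extendZero Ω f) (Ω : Set Vars)
  mem_dX : ∀ f ∈ carrier, partialDeriv Ω dirX f ∈ carrier
  mem_dTau : ∀ f ∈ carrier, partialDeriv Ω dirTau f ∈ carrier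
  mem_dT : ∀ f ∈ carrier, partialDeriv Ω dirT f ∈ carrier

namespace FunAlg

variable {Ω : TopologicalSpace.Opens Vars} (A : FunAlg Ω)

/-- `D = ∂/∂x`. -/
def dX (f : A.carrier) : A.carrier := ⟨partialDeriv Ω dirX f, A.mem_dX f f.2⟩
/-- `∂/∂τ_k`. -/
def dTau (f : A.carrier) : A.carrier := ⟨partialDeriv Ω dirTau f, A.mem_dTau f f.2⟩
/-- `∂/∂t_n`. -/
def dT (f : A.carrier) : A.carrier := ⟨partialDeriv Ω dirT f, A.mem_dT f f.2⟩

end FunAlg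

/-- A function algebra with an ideal `J`, closed under the three partial derivatives, on which
`D` is invertible (`D D⁻¹ = D⁻¹ D = 1`). For instance: `J` the smooth functions which, with all their
derivatives, decay rapidly as `x → -∞`, inside the algebra of smooth functions of at most polynomial
growth there; then `D⁻¹{f} = ∫_{-∞}^x f`. -/
structure FunClass (Ω : TopologicalSpace.Opens Vars) extends FunAlg Ω where
  J : Ideal carrier
  dX_bijOn : Set.BijOn toFunAlg.dX (J : Set carrier) (J : Set carrier)
  dTau_mem : ∀ f ∈ J, toFunAlg.dTau f ∈ J
  dT_mem : ∀ f ∈ J, toFunAlg.dT f ∈ J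

section operators

variable {Ω : TopologicalSpace.Opens Vars} (F : FunClass Ω)

/-- `D⁻¹{f}`: for `f ∈ J`, the unique `g ∈ J` with `D{g} = f` (only used for `f ∈ J`). -/
def dInv : F.carrier → F.carrier := Function.invFunOn F.dX (F.J : Set F.carrier)

/-- Matrix functions with `a` rows and `b` columns. -/
abbrev MatFun (a b : ℕ) : Type := Matrix (Fin a) (Fin b) F.carrier

variable {F}

/-- All entries lie in `J`. -/
def InJ {a b : ℕ} (f : MatFun F a b) : Prop := ∀ i j, f i j ∈ F.J

variable (F) in
/-- A constant matrix as a matrix function. -/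
def const {a b : ℕ} (X : Matrix (Fin a) (Fin b) ℂ) : MatFun F a b :=
  X.map (algebraMap ℂ F.carrier)

/-- `D`, `∂_τ`, `∂_t`, `D⁻¹` on matrix functions, entrywise. -/
def mX {a b : ℕ} (f : MatFun F a b) : MatFun F a b := f.map F.dX
def mTau {a b : ℕ} (f : MatFun F a b) : MatFun F a b := f.map F.dTau
def mT {a b : ℕ} (f : MatFun F a b) : MatFun F a b := f.map F.dT
def mInv {a b : ℕ} (f : MatFun F a b) : MatFun F a b := f.map (dInv F)

/-- `∑_{j=0}^{k} u_j D^j`, acting on `f`. -/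
def diffOp {N p : ℕ} (k : ℕ) (u : ℕ → MatFun F N N) (f : MatFun F N p) : MatFun F N p :=
  ∑ j ∈ Finset.range (k + 1), u j * mX^[j] f

/-- The formal transpose `∑_{j=0}^{k} (-1)^j D^j u_jᵀ`, acting on `f`. -/
def diffOpT {N p : ℕ} (k : ℕ) (u : ℕ → MatFun F N N) (f : MatFun F N p) : MatFun F N p :=
  ∑ j ∈ Finset.range (k + 1), (-1 : ℂ) ^ j • mX^[j] ((u j).transpose * f)

/-- `g D⁻¹ hᵀ`, acting on `f`. -/
def intOp {N m p : ℕ} (g h : MatFun F N m) (f : MatFun F N p) : MatFun F N p :=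
  g * mInv (h.transpose * f)

/-- The formal transpose `-h D⁻¹ gᵀ` of `g D⁻¹ hᵀ`, acting on `f`. -/
def intOpT {N m p : ℕ} (g h : MatFun F N m) (f : MatFun F N p) : MatFun F N p :=
  -(h * mInv (g.transpose * f))

end operators

/-- The data of the pair `L_k`, `M_{n,l}`. Only `u 0, …, u k` and `v 0, …, v n` are used. -/
structure LaxData {Ω : TopologicalSpace.Opens Vars} (F : FunClass Ω) (N m : ℕ) where
  k : ℕ
  n : ℕ
  l : ℕ
  β : ℂ
  α : ℂ
  c : ℂ
  u : ℕ → MatFun F N N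
  v : ℕ → MatFun F N N
  q : MatFun F N m
  r : MatFun F N m
  M0 : Matrix (Fin m) (Fin m) ℂ

namespace LaxData

variable {Ω : TopologicalSpace.Opens Vars} {F : FunClass Ω} {N m : ℕ} (P : LaxData F N m)

/-- `L_k = β ∂_τ - ∑ u_j D^j - q M₀ D⁻¹ rᵀ`. -/
def L {p : ℕ} (f : MatFun F N p) : MatFun F N p :=
  P.β • mTau f - diffOp P.k P.u f - intOp (P.q * const F P.M0) P.r f

/-- The formal transpose of `L_k`. -/
def LT {p : ℕ} (f : MatFun F N p) : MatFun F N p :=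
  -(P.β • mTau f) - diffOpT P.k P.u f - intOpT (P.q * const F P.M0) P.r f

/-- `M_{n,l} = α ∂_t - ∑ v_i D^i - c ∑_{j=0}^l q[j] M₀ D⁻¹ r[l-j]ᵀ`, where `q[j] = L_k^j{q}` and
`r[j] = (L_k^τ)^j{r}`. -/
def M {p : ℕ} (f : MatFun F N p) : MatFun F N p :=
  P.α • mT f - diffOp P.n P.v f
    - P.c • ∑ j ∈ Finset.range (P.l + 1),
        intOp (P.L^[j] P.q * const F P.M0) (P.LT^[P.l - j] P.r) f

/-- The formal transpose of `M_{n,l}`. -/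
def MT {p : ℕ} (f : MatFun F N p) : MatFun F N p :=
  -(P.α • mT f) - diffOpT P.n P.v f
    - P.c • ∑ j ∈ Finset.range (P.l + 1),
        intOpT (P.L^[j] P.q * const F P.M0) (P.LT^[P.l - j] P.r) f

/-- `M̃_{n,l} = M_{n,l} - c L_k^{l+1}`. -/
def Mtilde {p : ℕ} (f : MatFun F N p) : MatFun F N p :=
  P.M f - P.c • P.L^[P.l + 1] f

/-- The formal transpose of `M̃_{n,l}`. -/
def MtildeT {p : ℕ} (f : MatFun F N p) : MatFun F N p :=
  P.MT f - P.c • P.LT^[P.l + 1] f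

end LaxData

/-- The data of a binary Darboux transformation. -/
structure DarbouxData {Ω : TopologicalSpace.Opens Vars} (F : FunClass Ω) (N K : ℕ) where
  φ : MatFun F N K
  ψ : MatFun F N K
  C : Matrix (Fin K) (Fin K) ℂ

namespace DarbouxData

variable {Ω : TopologicalSpace.Opens Vars} {F : FunClass Ω} {N K : ℕ} (B : DarbouxData F N K)

/-- `Δ = C + D⁻¹{ψᵀ φ}`. -/
def Δ : MatFun F K K := const F B.C + mInv (B.ψ.transpose * B.φ)

/-- `W = I - φ Δ⁻¹ D⁻¹ ψᵀ`. -/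
def W {p : ℕ} (f : MatFun F N p) : MatFun F N p :=
  f - intOp (B.φ * B.Δ⁻¹) B.ψ f

/-- `W⁻¹ = I + φ D⁻¹ Δ⁻¹ ψᵀ`. -/
def Winv {p : ℕ} (f : MatFun F N p) : MatFun F N p :=
  f + intOp B.φ (B.ψ * B.Δ⁻¹.transpose) f

/-- The formal transpose `W^τ`. -/
def WT {p : ℕ} (f : MatFun F N p) : MatFun F N p :=
  f - intOpT (B.φ * B.Δ⁻¹) B.ψ f

/-- The formal transpose `W^{-1,τ}` of `W⁻¹`. -/
def WinvT {p : ℕ} (f : MatFun F N p) : MatFun F N p :=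
  f + intOpT B.φ (B.ψ * B.Δ⁻¹.transpose) f

/-- `Φ = W{φ} C⁻¹`. -/
def Φ : MatFun F N K := B.W B.φ * const F B.C⁻¹

/-- `Ψ = W^{-1,τ}{ψ} C^{⊤,-1}`. -/
def Ψ : MatFun F N K := B.WinvT B.ψ * const F B.C.transpose⁻¹

/-- `W X W⁻¹`. -/
def conj {p : ℕ} (X : MatFun F N p → MatFun F N p) (f : MatFun F N p) : MatFun F N p :=
  B.W (X (B.Winv f))

/-- `(W X W⁻¹)^τ = W^{-1,τ} X^τ W^τ`, as a function of `X^τ`. -/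
def conjT {p : ℕ} (XT : MatFun F N p → MatFun F N p) (f : MatFun F N p) : MatFun F N p :=
  B.WinvT (XT (B.WT f))

end DarbouxData

section dressed

variable {Ω : TopologicalSpace.Opens Vars} {F : FunClass Ω} {N m K : ℕ}
  (P : LaxData F N m) (B : DarbouxData F N K)

/-- `L̂_k = W L_k W⁻¹` and its transpose. -/
def Lhat {p : ℕ} : MatFun F N p → MatFun F N p := B.conj P.L
def LhatT {p : ℕ} : MatFun F N p → MatFun F N p := B.conjT P.LT
/-- `M̂_{n,l} = W M_{n,l} W⁻¹` and its transpose. -/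
def Mhat {p : ℕ} : MatFun F N p → MatFun F N p := B.conj P.M
def MhatT {p : ℕ} : MatFun F N p → MatFun F N p := B.conjT P.MT
/-- `W M̃_{n,l} W⁻¹` and its transpose. -/
def MtildeHat {p : ℕ} : MatFun F N p → MatFun F N p := B.conj P.Mtilde
def MtildeHatT {p : ℕ} : MatFun F N p → MatFun F N p := B.conjT P.MtildeT

/-- `q̂ = W{q}` and `r̂ = W^{-1,τ}{r}`. -/
def qhat : MatFun F N m := B.W P.q
def rhat : MatFun F N m := B.WinvT P.r

/-- `ℳ₁ = C Λ - Λ'ᵀ C`. -/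
def M1 (Λ Λ' : Matrix (Fin K) (Fin K) ℂ) : Matrix (Fin K) (Fin K) ℂ :=
  B.C * Λ - Λ'.transpose * B.C

/-- The integro-differential operator
`β ∂_τ - ∑_{j=0}^k û_j D^j - q̂ M₀ D⁻¹ r̂ᵀ + Φ ℳ₁ D⁻¹ Ψᵀ` and its formal transpose. -/
def LhatForm (Λ Λ' : Matrix (Fin K) (Fin K) ℂ) (û : ℕ → MatFun F N N) {p : ℕ}
    (f : MatFun F N p) : MatFun F N p :=
  P.β • mTau f - diffOp P.k û f - intOp (qhat P B * const F P.M0) (rhat P B) f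
    + intOp (B.Φ * const F (M1 B Λ Λ')) B.Ψ f

def LhatFormT (Λ Λ' : Matrix (Fin K) (Fin K) ℂ) (û : ℕ → MatFun F N N) {p : ℕ}
    (f : MatFun F N p) : MatFun F N p :=
  -(P.β • mTau f) - diffOpT P.k û f - intOpT (qhat P B * const F P.M0) (rhat P B) f
    + intOpT (B.Φ * const F (M1 B Λ Λ')) B.Ψ f

/-- The integro-differential operator
`α ∂_t - ∑_{i=0}^n v̂_i D^i - c ∑_{j=0}^l q̂[j] M₀ D⁻¹ r̂[l-j]ᵀ + c ∑_{s=0}^l Φ[s] ℳ₁ D⁻¹ Ψ[l-s]ᵀ`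
and its formal transpose, where `[j]` denotes `L̂_k^j` applied to `q̂`, `Φ` and `(L̂_k^τ)^j` applied
to `r̂`, `Ψ`. -/
def MhatForm (Λ Λ' : Matrix (Fin K) (Fin K) ℂ) (v' : ℕ → MatFun F N N) {p : ℕ}
    (f : MatFun F N p) : MatFun F N p :=
  P.α • mT f - diffOp P.n v' f
    - P.c • ∑ j ∈ Finset.range (P.l + 1),
        intOp ((Lhat P B)^[j] (qhat P B) * const F P.M0) ((LhatT P B)^[P.l - j] (rhat P B)) f
    + P.c • ∑ s ∈ Finset.range (P.l + 1),
        intOp ((Lhat P B)^[s] B.Φ * const F (M1 B Λ Λ')) ((LhatT P B)^[P.l - s] B.Ψ) f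

def MhatFormT (Λ Λ' : Matrix (Fin K) (Fin K) ℂ) (v' : ℕ → MatFun F N N) {p : ℕ}
    (f : MatFun F N p) : MatFun F N p :=
  -(P.α • mT f) - diffOpT P.n v' f
    - P.c • ∑ j ∈ Finset.range (P.l + 1),
        intOpT ((Lhat P B)^[j] (qhat P B) * const F P.M0) ((LhatT P B)^[P.l - j] (rhat P B)) f
    + P.c • ∑ s ∈ Finset.range (P.l + 1),
        intOpT ((Lhat P B)^[s] B.Φ * const F (M1 B Λ Λ')) ((LhatT P B)^[P.l - s] B.Ψ) f

end dressed

end BDKP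

end

open BDKP

open scoped ContDiff

noncomputable section

namespace BDKP

/-! ### Partial derivatives as commuting derivations of the algebra. -/

section derivations

variable {Ω : TopologicalSpace.Opens Vars}

/-! The proof is a computation in the ring `OpRing` of pairs (operator on $J$, formal transpose),
the second factor carrying the opposite multiplication. An identity between matrices over this ring
holds for the operators and for their transposes at once, and `Rep.unique` and `Rep.uniqueT` turn it
into equalities of actions on functions with entries in $J$.

The engine is integration by parts, $D^{-1}f'D^{-1}=fD^{-1}-D^{-1}f$. Since
$\Delta'=\psi^\top\varphi$, it gives $W\varphi D^{-1}=\varphi\Delta^{-1}D^{-1}\Delta$ (`WR_mul_φ`),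
and with it the inversion of $W$.

For an operator $Y$ put $f=Y\{\varphi\}$ and $\rho=(Y^\tau\{\psi\})^\top$. The relation `Dresses`
says
$$WYW^{-1}=Y'+Wf\,D^{-1}\Delta^{-1}\psi^\top-\varphi\Delta^{-1}D^{-1}(\rho+E\Delta^{-1}\psi^\top),$$
where $E$ has entries in $J$ and $E'=\psi^\top f-\rho\varphi$. It is additive in $Y$, so it suffices
to check it for a derivation, for $\sum u_jD^j$ and for $gD^{-1}h^\top$. The eigenvalue equations
are needed only for the sum: if $f=\varphi S$ and $\rho=S'^\top\psi^\top$, injectivity of $D$ on $J$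
forces $E=(\Delta-C)S-S'^\top(\Delta-C)$, and the two nonlocal terms collapse to
$\varphi\Delta^{-1}(CS-S'^\top C)D^{-1}\Delta^{-1}\psi^\top$ (`Dresses.conj_eq`).

For $L$ take $S=\Lambda$, $S'=\tilde\Lambda$. For $M$ take $S=c\Lambda^{l+1}$,
$S'=c\tilde\Lambda^{l+1}$; as $\Phi[s]=\varphi\Delta^{-1}C\Lambda^sC^{-1}$, and similarly for
$\Psi$, a telescoping sum (`sum_telescope`) splits this single term into the stated $l+1$ terms. The
equations for $\Phi,\Psi$ and the Lax equation then follow by cancelling $W^{-1}W$. -/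

theorem extendZero_apply (f : Ω → ℂ) (p : Ω) : extendZero Ω f p = f p :=
  Subtype.val_injective.extend_apply f 0 p

theorem eventually_extendZero {f : Ω → ℂ} {g : Vars → ℂ} (p : Ω) (h : ∀ q : Ω, f q = g q) :
    extendZero Ω f =ᶠ[nhds (p : Vars)] g := by
  filter_upwards [Ω.isOpen.mem_nhds p.2] with x hx
  exact (extendZero_apply f ⟨x, hx⟩).trans (h ⟨x, hx⟩)

namespace FunAlg

variable (A : FunAlg Ω)

theorem contDiffAt (f : A.carrier) (p : Ω) : ContDiffAt ℝ 2 (extendZero Ω f) p :=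
  contDiffAt_infty.1 ((A.smooth f f.2).contDiffAt (Ω.isOpen.mem_nhds p.2)) 2

theorem differentiableAt (f : A.carrier) (p : Ω) : DifferentiableAt ℝ (extendZero Ω f) p :=
  (A.contDiffAt f p).differentiableAt (by simp)

theorem partialDeriv_apply (e : Vars) (f : A.carrier) (p : Ω) :
    partialDeriv Ω e f p = fderiv ℝ (extendZero Ω f) p e :=
  (A.differentiableAt f p).lineDeriv_eq_fderiv

theorem partialDeriv_add (e : Vars) (f g : A.carrier) :
    partialDeriv Ω e (f + g : A.carrier) = partialDeriv Ω e f + partialDeriv Ω e g := by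
  ext p
  have h := eventually_extendZero (f := (f + g : A.carrier)) (g := extendZero Ω f + extendZero Ω g)
    p (fun q => by simp [extendZero_apply])
  rw [Pi.add_apply, A.partialDeriv_apply, A.partialDeriv_apply, A.partialDeriv_apply, h.fderiv_eq,
    fderiv_add (A.differentiableAt f p) (A.differentiableAt g p)]
  rfl

theorem partialDeriv_mul (e : Vars) (f g : A.carrier) :
    partialDeriv Ω e (f * g : A.carrier) =
      (f : Ω → ℂ) * partialDeriv Ω e g + (g : Ω → ℂ) * partialDeriv Ω e f := by
  ext p
  have h := eventually_extendZero (f := (f * g : A.carrier)) (g := extendZero Ω f * extendZero Ω g)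
    p (fun q => by simp [extendZero_apply])
  rw [Pi.add_apply, Pi.mul_apply, Pi.mul_apply, A.partialDeriv_apply, A.partialDeriv_apply,
    A.partialDeriv_apply, h.fderiv_eq,
    fderiv_mul (A.differentiableAt f p) (A.differentiableAt g p)]
  simp [extendZero_apply]

theorem partialDeriv_algebraMap (e : Vars) (z : ℂ) :
    partialDeriv Ω e (algebraMap ℂ A.carrier z) = 0 := by
  ext p
  have h := eventually_extendZero (f := (algebraMap ℂ A.carrier z : A.carrier)) (g := fun _ => z)
    p (fun q => rfl)
  rw [A.partialDeriv_apply, h.fderiv_eq]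
  simp

/-- Near a point of the open set `Ω` the extended partial derivative is the Fréchet derivative
evaluated at `e`, so iterated partials reduce to the second Fréchet derivative, which is symmetric.
-/
theorem fderiv_partialDeriv (e e' : Vars) (f : A.carrier) (p : Ω) :
    fderiv ℝ (extendZero Ω (partialDeriv Ω e f)) p e' =
      fderiv ℝ (fderiv ℝ (extendZero Ω f)) p e' e := by
  have h := eventually_extendZero (f := partialDeriv Ω e f)
    (g := fun x => fderiv ℝ (extendZero Ω f) x e) p (A.partialDeriv_apply e f)
  have hd : DifferentiableAt ℝ (fderiv ℝ (extendZero Ω f)) p :=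
    ((A.contDiffAt f p).fderiv_right (m := 1) (by norm_num)).differentiableAt (by simp)
  rw [h.fderiv_eq, fderiv_clm_apply hd (differentiableAt_const e)]
  simp

theorem fderiv_partialDeriv_comm (e e' : Vars) (f : A.carrier) (p : Ω) :
    fderiv ℝ (extendZero Ω (partialDeriv Ω e f)) p e' =
      fderiv ℝ (extendZero Ω (partialDeriv Ω e' f)) p e := by
  rw [A.fderiv_partialDeriv, A.fderiv_partialDeriv]
  exact ((A.contDiffAt f p).isSymmSndFDerivAt (by simp)) e' e

/-- A partial derivative that preserves the algebra, as a derivation. -/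
def partialDer (e : Vars) (h : ∀ f ∈ A.carrier, partialDeriv Ω e f ∈ A.carrier) :
    Derivation ℂ A.carrier A.carrier :=
  Derivation.mk'
    { toFun := fun f => ⟨partialDeriv Ω e f, h f f.2⟩
      map_add' := fun f g => Subtype.ext (A.partialDeriv_add e f g)
      map_smul' := fun z f => Subtype.ext (by
        change partialDeriv Ω e (z • f : A.carrier) = z • partialDeriv Ω e f
        rw [Algebra.smul_def, A.partialDeriv_mul, A.partialDeriv_algebraMap]
        ext p
        simp only [Pi.add_apply, Pi.mul_apply, Pi.smul_apply, Pi.zero_apply, mul_zero, add_zero,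
          smul_eq_mul]
        rfl) }
    fun f g => Subtype.ext (A.partialDeriv_mul e f g)

/-- `D` as a derivation. -/
def dXDer : Derivation ℂ A.carrier A.carrier := A.partialDer dirX A.mem_dX

/-- `∂_τ` as a derivation. -/
def dTauDer : Derivation ℂ A.carrier A.carrier := A.partialDer dirTau A.mem_dTau

/-- `∂_t` as a derivation. -/
def dTDer : Derivation ℂ A.carrier A.carrier := A.partialDer dirT A.mem_dT

theorem dX_dTau (f : A.carrier) : A.dX (A.dTau f) = A.dTau (A.dX f) := by
  apply Subtype.ext
  ext p
  change partialDeriv Ω dirX (A.dTau f) p = partialDeriv Ω dirTau (A.dX f) p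
  rw [A.partialDeriv_apply, A.partialDeriv_apply]
  exact A.fderiv_partialDeriv_comm dirTau dirX f p

theorem dX_dT (f : A.carrier) : A.dX (A.dT f) = A.dT (A.dX f) := by
  apply Subtype.ext
  ext p
  change partialDeriv Ω dirX (A.dT f) p = partialDeriv Ω dirT (A.dX f) p
  rw [A.partialDeriv_apply, A.partialDeriv_apply]
  exact A.fderiv_partialDeriv_comm dirT dirX f p

end FunAlg

end derivations

section operatorCalculus

local instance {Ω : TopologicalSpace.Opens Vars} (F : FunClass Ω) : CommRing F.carrier :=
  Subalgebra.toCommRing F.carrier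
local instance {Ω : TopologicalSpace.Opens Vars} (F : FunClass Ω) : Algebra ℂ F.carrier :=
  Subalgebra.algebra F.carrier
local instance {Ω : TopologicalSpace.Opens Vars} (F : FunClass Ω) : AddCommGroup F.J :=
  Submodule.addCommGroup F.J
local instance {Ω : TopologicalSpace.Opens Vars} (F : FunClass Ω) : Module ℂ F.J :=
  Submodule.module' F.J
local instance {Ω : TopologicalSpace.Opens Vars} (F : FunClass Ω) : Ring (Module.End ℂ F.J) :=
  Module.End.instRing

/-! ### The ring of operators on $J$ paired with their transposes. -/

section operatorRing

open MulOpposite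

variable {Ω : TopologicalSpace.Opens Vars} (F : FunClass Ω)

/-- Pairs consisting of an operator on `J` and its formal transpose. -/
def OpRing : Type := Module.End ℂ F.J × (Module.End ℂ F.J)ᵐᵒᵖ

instance : Ring (OpRing F) :=
  inferInstanceAs (Ring (Module.End ℂ F.J × (Module.End ℂ F.J)ᵐᵒᵖ))

/-- A derivation of the algebra that preserves `J` and commutes with `D`. -/
structure JDerivation where
  der : Derivation ℂ F.carrier F.carrier
  mem : ∀ f ∈ F.J, der f ∈ F.J
  comm : ∀ f, F.dX (der f) = der (F.dX f)

instance : Algebra ℂ (OpRing F) :=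
  inferInstanceAs (Algebra ℂ (Module.End ℂ F.J × (Module.End ℂ F.J)ᵐᵒᵖ))

variable {F}

/-- Scalar multiples of derivations. -/
def JDerivation.smul (z : ℂ) (δ : JDerivation F) : JDerivation F where
  der := z • δ.der
  mem := fun f hf => Submodule.smul_of_tower_mem F.J z (δ.mem f hf)
  comm := fun f => by
    have h : F.dX (z • δ.der f) = z • F.dX (δ.der f) := F.dXDer.map_smul z (δ.der f)
    rw [Derivation.smul_apply, h, δ.comm, Derivation.smul_apply]

variable (F)

/-- `D`. -/
def derX : JDerivation F := ⟨F.dXDer, fun _ hf => F.dX_bijOn.mapsTo hf, fun _ => rfl⟩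
/-- `∂_τ`. -/
def derTau : JDerivation F := ⟨F.dTauDer, F.dTau_mem, F.dX_dTau⟩
/-- `∂_t`. -/
def derT : JDerivation F := ⟨F.dTDer, F.dT_mem, F.dX_dT⟩

variable {F}

/-- The action of a derivation on `J`. -/
def derEnd (δ : JDerivation F) : Module.End ℂ F.J where
  toFun f := ⟨δ.der f, δ.mem f f.2⟩
  map_add' f g := Subtype.ext (δ.der.map_add f g)
  map_smul' z f := Subtype.ext (δ.der.map_smul z (f : F.carrier))

theorem dInv_mem {f : F.carrier} (hf : f ∈ F.J) : dInv F f ∈ F.J :=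
  Function.invFunOn_mem (F.dX_bijOn.surjOn hf)

theorem dX_dInv {f : F.carrier} (hf : f ∈ F.J) : F.dX (dInv F f) = f :=
  Function.invFunOn_eq (F.dX_bijOn.surjOn hf)

theorem dX_inj {f g : F.carrier} (hf : f ∈ F.J) (hg : g ∈ F.J) (h : F.dX f = F.dX g) : f = g :=
  F.dX_bijOn.injOn hf hg h

theorem dInv_dX {f : F.carrier} (hf : f ∈ F.J) : dInv F (F.dX f) = f :=
  have h := F.dX_bijOn.mapsTo hf
  dX_inj (dInv_mem h) hf (dX_dInv h)

variable (F) in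
/-- The action of `D⁻¹` on `J`. -/
def invEnd : Module.End ℂ F.J where
  toFun f := ⟨dInv F f, dInv_mem f.2⟩
  -- Linearity of $D^{-1}$: both sides lie in $J$ and have the same image under the injective $D$.
  map_add' f g := Subtype.ext <| dX_inj (dInv_mem (F.J.add_mem f.2 g.2))
    (F.J.add_mem (dInv_mem f.2) (dInv_mem g.2)) (by
      refine (dX_dInv (F.J.add_mem f.2 g.2)).trans ?_
      refine Eq.trans ?_ (F.dXDer.map_add (dInv F f) (dInv F g)).symm
      exact congrArg₂ _ (dX_dInv f.2).symm (dX_dInv g.2).symm)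
  map_smul' z f := Subtype.ext <| dX_inj (dInv_mem (F.J.smul_of_tower_mem z f.2))
    (F.J.smul_of_tower_mem z (dInv_mem f.2)) (by
      refine (dX_dInv (F.J.smul_of_tower_mem z f.2)).trans ?_
      refine Eq.trans ?_ (F.dXDer.map_smul z (dInv F f)).symm
      exact congrArg (z • ·) (dX_dInv f.2).symm)

/-- A derivation together with its transpose. -/
def derOp (δ : JDerivation F) : OpRing F := (derEnd δ, op (-derEnd δ))

variable (F) in
/-- `D⁻¹` together with its transpose. -/
def invOp : OpRing F := (invEnd F, op (-invEnd F))

/-- Multiplication by a function on `J`. -/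
def mulEnd (a : F.carrier) : Module.End ℂ F.J where
  toFun f := ⟨a * f, F.J.mul_mem_left a f.2⟩
  map_add' f g := Subtype.ext (mul_add a (f : F.carrier) g)
  map_smul' z f := Subtype.ext (mul_smul_comm z a (f : F.carrier))

variable (F) in
/-- Multiplication by a function, together with its transpose. -/
def mulOp : F.carrier →+* OpRing F where
  toFun a := (mulEnd a, op (mulEnd a))
  map_one' := by
    have h : mulEnd (1 : F.carrier) = 1 := LinearMap.ext fun f => Subtype.ext (one_mul _)
    rw [h]; rfl
  map_zero' := by
    have h : mulEnd (0 : F.carrier) = 0 := LinearMap.ext fun f => Subtype.ext (zero_mul _)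
    rw [h]; rfl
  map_add' a b := by
    have h : mulEnd (a + b) = mulEnd a + mulEnd b :=
      LinearMap.ext fun f => Subtype.ext (add_mul _ _ _)
    rw [h]; rfl
  map_mul' a b := by
    have h (a b : F.carrier) : mulEnd (a * b) = mulEnd a * mulEnd b :=
      LinearMap.ext fun f => Subtype.ext (mul_assoc _ _ _)
    refine Prod.ext (h a b) (congrArg op ?_)
    rw [mul_comm a b]
    exact h b a

theorem mulOp_smul (z : ℂ) (a : F.carrier) : mulOp F (z • a) = z • mulOp F a := by
  have h : mulEnd (z • a) = z • mulEnd a :=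
    LinearMap.ext fun f => Subtype.ext (smul_mul_assoc z a (f : F.carrier))
  exact Prod.ext h (congrArg op h)

/-- The Leibniz rule. In the transposed component products are reversed and $\delta$ becomes
$-\delta$, so the rule keeps its form. -/
theorem derOp_mul_mulOp (δ : JDerivation F) (a : F.carrier) :
    derOp δ * mulOp F a = mulOp F a * derOp δ + mulOp F (δ.der a) := by
  refine Prod.ext ?_ (unop_injective ?_)
  · ext f : 1
    apply Subtype.ext
    change δ.der (a * f) = a * δ.der f + δ.der a * f
    rw [Derivation.leibniz, smul_eq_mul, smul_eq_mul, mul_comm (f : F.carrier)]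
  · ext f : 1
    apply Subtype.ext
    change a * -δ.der f = -δ.der (a * f) + δ.der a * f
    rw [Derivation.leibniz, smul_eq_mul, smul_eq_mul]
    ring

theorem derOp_comm (δ : JDerivation F) :
    derOp δ * derOp (derX F) = derOp (derX F) * derOp δ := by
  refine Prod.ext ?_ (unop_injective ?_)
  · ext f : 1
    apply Subtype.ext
    exact (δ.comm f).symm
  · ext f : 1
    apply Subtype.ext
    change -F.dXDer (-δ.der f) = -δ.der (-F.dX f)
    rw [map_neg, map_neg]
    exact congrArg (- -·) (δ.comm f)

theorem derX_mul_invOp : derOp (derX F) * invOp F = 1 := by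
  refine Prod.ext ?_ (unop_injective ?_)
  · ext f : 1
    exact Subtype.ext (dX_dInv f.2)
  · change -invEnd F * -derEnd (derX F) = 1
    rw [neg_mul_neg]
    ext f : 1
    exact Subtype.ext (dInv_dX f.2)

theorem invOp_mul_derX : invOp F * derOp (derX F) = 1 := by
  refine Prod.ext ?_ (unop_injective ?_)
  · ext f : 1
    exact Subtype.ext (dInv_dX f.2)
  · change -derEnd (derX F) * -invEnd F = 1
    rw [neg_mul_neg]
    ext f : 1
    exact Subtype.ext (dX_dInv f.2)

/-- What commutes with $D$ commutes with its two-sided inverse. -/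
theorem derOp_mul_invOp (δ : JDerivation F) : derOp δ * invOp F = invOp F * derOp δ := by
  calc derOp δ * invOp F = invOp F * (derOp (derX F) * derOp δ) * invOp F := by
        rw [← mul_assoc, invOp_mul_derX, one_mul]
    _ = invOp F * derOp δ * (derOp (derX F) * invOp F) := by
        rw [← derOp_comm]; simp only [mul_assoc]
    _ = _ := by rw [derX_mul_invOp, mul_one]

/-- Integration by parts: the Leibniz rule $a'=Da-aD$ between two factors $D^{-1}$. -/
theorem invOp_mul_mulOp_mul_invOp (a : F.carrier) :
    invOp F * mulOp F (F.dX a) * invOp F = mulOp F a * invOp F - invOp F * mulOp F a := by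
  have h : mulOp F (F.dX a) = derOp (derX F) * mulOp F a - mulOp F a * derOp (derX F) :=
    eq_sub_of_add_eq' (derOp_mul_mulOp (derX F) a).symm
  rw [h, mul_sub, sub_mul, ← mul_assoc, invOp_mul_derX, one_mul, mul_assoc, mul_assoc,
    derX_mul_invOp, mul_one]

end operatorRing

/-! ### Matrices of operators and of functions. -/

section operatorMatrices

variable {Ω : TopologicalSpace.Opens Vars} {F : FunClass Ω} {a b e : ℕ}

/-- Matrices of operators. -/
abbrev OpMat (F : FunClass Ω) (a b : ℕ) : Type := Matrix (Fin a) (Fin b) (OpRing F)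

/-- The operator of multiplication by a matrix function. -/
def em (f : MatFun F a b) : OpMat F a b := f.map (mulOp F)

variable (F) in
/-- A scalar operator as a matrix. -/
def sc (a : ℕ) (x : OpRing F) : OpMat F a a := Matrix.diagonal fun _ => x

/-- A derivation, acting entrywise. -/
def JDerivation.mat (δ : JDerivation F) (f : MatFun F a b) : MatFun F a b := f.map δ.der

theorem mX_eq (f : MatFun F a b) : mX f = (derX F).mat f := rfl

theorem em_mul (f : MatFun F a b) (g : MatFun F b e) : em (f * g) = em f * em g :=
  Matrix.map_mul

theorem em_add (f g : MatFun F a b) : em (f + g) = em f + em g :=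
  Matrix.map_add _ (map_add _) _ _

theorem em_sub (f g : MatFun F a b) : em (f - g) = em f - em g :=
  Matrix.map_sub _ (map_sub _) _ _

theorem em_neg (f : MatFun F a b) : em (-f) = -em f := by
  ext i j : 1
  exact map_neg (mulOp F) _

theorem em_smul (z : ℂ) (f : MatFun F a b) : em (z • f) = z • em f := by
  ext i j : 1
  exact mulOp_smul z _

theorem em_zero : em (0 : MatFun F a b) = 0 := by
  ext i j : 1
  exact map_zero (mulOp F)

theorem em_one : em (1 : MatFun F a a) = 1 :=
  Matrix.map_one _ (map_zero _) (map_one _)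

theorem em_sum {ι : Type*} (s : Finset ι) (f : ι → MatFun F a b) :
    em (∑ i ∈ s, f i) = ∑ i ∈ s, em (f i) := by
  classical
  induction s using Finset.induction_on with
  | empty => exact em_zero
  | insert i s hi ih => rw [Finset.sum_insert hi, Finset.sum_insert hi, em_add, ih]

theorem sc_mul_apply (x : OpRing F) (X : OpMat F a b) (i : Fin a) (j : Fin b) :
    (sc F a x * X) i j = x * X i j := Matrix.diagonal_mul _ _ _ _

theorem mul_sc_apply (x : OpRing F) (X : OpMat F a b) (i : Fin a) (j : Fin b) :
    (X * sc F b x) i j = X i j * x := Matrix.mul_diagonal _ _ _ _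

theorem sc_mul_sc (x y : OpRing F) : sc F a x * sc F a y = sc F a (x * y) :=
  Matrix.diagonal_mul_diagonal _ _

theorem sc_one : sc F a 1 = 1 := Matrix.diagonal_one

/-- `D` as a matrix of operators. -/
abbrev opD (F : FunClass Ω) (a : ℕ) : OpMat F a a := sc F a (derOp (derX F))
/-- `D⁻¹` as a matrix of operators. -/
abbrev opI (F : FunClass Ω) (a : ℕ) : OpMat F a a := sc F a (invOp F)

theorem derOp_mul_em (δ : JDerivation F) (f : MatFun F a b) :
    sc F a (derOp δ) * em f = em f * sc F b (derOp δ) + em (δ.mat f) := by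
  ext i j : 1
  rw [Matrix.add_apply, sc_mul_apply, mul_sc_apply]
  exact derOp_mul_mulOp δ (f i j)

theorem opD_mul_em (f : MatFun F a b) : opD F a * em f = em f * opD F b + em (mX f) :=
  derOp_mul_em (derX F) f

theorem opI_mul_opD : opI F a * opD F a = 1 := by rw [sc_mul_sc, invOp_mul_derX, sc_one]

theorem opD_mul_opI : opD F a * opI F a = 1 := by rw [sc_mul_sc, derX_mul_invOp, sc_one]

theorem derOp_mul_opI (δ : JDerivation F) :
    sc F a (derOp δ) * opI F a = opI F a * sc F a (derOp δ) := by
  rw [sc_mul_sc, sc_mul_sc, derOp_mul_invOp]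

theorem opI_mul_em_mul_opI (f : MatFun F a b) :
    opI F a * em (mX f) * opI F b = em f * opI F b - opI F a * em f := by
  ext i j : 1
  rw [Matrix.sub_apply, mul_sc_apply, mul_sc_apply, sc_mul_apply, sc_mul_apply]
  exact invOp_mul_mulOp_mul_invOp (f i j)

theorem mat_const (δ : JDerivation F) (S : Matrix (Fin a) (Fin b) ℂ) :
    δ.mat (const F S) = 0 := by
  ext i j : 1
  exact δ.der.map_algebraMap _

theorem mX_const (S : Matrix (Fin a) (Fin b) ℂ) : mX (const F S) = 0 := mat_const (derX F) S

/-- Integration by parts with $S'=0$: constants pass through $D^{-1}$. -/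
theorem opI_mul_const (S : Matrix (Fin a) (Fin b) ℂ) :
    opI F a * em (const F S) = em (const F S) * opI F b := by
  have h := opI_mul_em_mul_opI (const F S)
  rw [mX_const, em_zero, Matrix.mul_zero, Matrix.zero_mul] at h
  exact (sub_eq_zero.1 h.symm).symm

theorem mat_add (δ : JDerivation F) (f g : MatFun F a b) : δ.mat (f + g) = δ.mat f + δ.mat g :=
  Matrix.map_add _ (map_add _) _ _

theorem mat_mul (δ : JDerivation F) (f : MatFun F a b) (g : MatFun F b e) :
    δ.mat (f * g) = δ.mat f * g + f * δ.mat g := by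
  ext i j : 1
  change δ.der ((f * g) i j) = (δ.mat f * g + f * δ.mat g) i j
  simp only [Matrix.mul_apply, map_sum, Matrix.add_apply, Derivation.leibniz, smul_eq_mul,
    ← Finset.sum_add_distrib]
  refine Finset.sum_congr rfl fun k _ => ?_
  rw [add_comm, mul_comm (g k j)]
  rfl

theorem mX_mul (f : MatFun F a b) (g : MatFun F b e) : mX (f * g) = mX f * g + f * mX g :=
  mat_mul (derX F) f g

theorem mX_add (f g : MatFun F a b) : mX (f + g) = mX f + mX g := mat_add (derX F) f g

theorem mX_sub (f g : MatFun F a b) : mX (f - g) = mX f - mX g :=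
  Matrix.map_sub _ (map_sub F.dXDer) _ _

theorem mX_neg (f : MatFun F a b) : mX (-f) = -mX f := by
  ext i j : 1
  exact map_neg F.dXDer _

theorem mX_zero : mX (0 : MatFun F a b) = 0 := by
  ext i j : 1
  exact map_zero F.dXDer

theorem mX_smul (z : ℂ) (f : MatFun F a b) : mX (z • f) = z • mX f := by
  ext i j : 1
  exact F.dXDer.map_smul z _

theorem mX_sum {ι : Type*} (s : Finset ι) (f : ι → MatFun F a b) :
    mX (∑ i ∈ s, f i) = ∑ i ∈ s, mX (f i) := by
  classical
  induction s using Finset.induction_on with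
  | empty => exact mX_zero
  | insert i s hi ih => rw [Finset.sum_insert hi, Finset.sum_insert hi, mX_add, ih]

theorem mX_mat (δ : JDerivation F) (f : MatFun F a b) : mX (δ.mat f) = δ.mat (mX f) := by
  ext i j : 1
  exact δ.comm _

theorem mX_transpose (f : MatFun F a b) : mX f.transpose = (mX f).transpose := rfl

theorem mX_iterate_transpose (n : ℕ) (f : MatFun F a b) :
    mX^[n] f.transpose = (mX^[n] f).transpose := by
  induction n with
  | zero => rfl
  | succ n ih => rw [Function.iterate_succ_apply', ih, Function.iterate_succ_apply', mX_transpose]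

theorem InJ.transpose {f : MatFun F a b} (hf : InJ f) : InJ f.transpose := fun i j => hf j i

theorem InJ.add {f g : MatFun F a b} (hf : InJ f) (hg : InJ g) : InJ (f + g) :=
  fun i j => F.J.add_mem (hf i j) (hg i j)

theorem InJ.sub {f g : MatFun F a b} (hf : InJ f) (hg : InJ g) : InJ (f - g) :=
  fun i j => F.J.sub_mem (hf i j) (hg i j)

theorem InJ.neg {f : MatFun F a b} (hf : InJ f) : InJ (-f) := fun i j => F.J.neg_mem (hf i j)

theorem InJ.zero : InJ (0 : MatFun F a b) := fun _ _ => F.J.zero_mem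

theorem InJ.smul {f : MatFun F a b} (z : ℂ) (hf : InJ f) : InJ (z • f) :=
  fun i j => F.J.smul_of_tower_mem z (hf i j)

theorem InJ.sum {ι : Type*} {s : Finset ι} {f : ι → MatFun F a b} (h : ∀ i ∈ s, InJ (f i)) :
    InJ (∑ i ∈ s, f i) := fun i j => by
  rw [Matrix.sum_apply]
  exact F.J.sum_mem fun k hk => h k hk i j

theorem InJ.mul_left {f : MatFun F b e} (g : MatFun F a b) (hf : InJ f) : InJ (g * f) :=
  fun i j => by
    rw [Matrix.mul_apply]
    exact F.J.sum_mem fun k _ => F.J.mul_mem_left _ (hf k j)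

theorem InJ.mul_right {f : MatFun F a b} (hf : InJ f) (g : MatFun F b e) : InJ (f * g) :=
  fun i j => by
    rw [Matrix.mul_apply]
    exact F.J.sum_mem fun k _ => F.J.mul_mem_right _ (hf i k)

theorem InJ.mat {f : MatFun F a b} (δ : JDerivation F) (hf : InJ f) : InJ (δ.mat f) :=
  fun i j => δ.mem _ (hf i j)

theorem InJ.mX {f : MatFun F a b} (hf : InJ f) : InJ (mX f) := hf.mat (derX F)

theorem InJ.mInv {f : MatFun F a b} (hf : InJ f) : InJ (mInv f) := fun i j => dInv_mem (hf i j)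

theorem mX_mInv {f : MatFun F a b} (hf : InJ f) : mX (mInv f) = f := by
  ext i j : 1
  exact dX_dInv (hf i j)

theorem mX_inj {f g : MatFun F a b} (hf : InJ f) (hg : InJ g) (h : mX f = mX g) : f = g := by
  ext i j : 1
  exact dX_inj (hf i j) (hg i j) (congrFun₂ h i j)

theorem mInv_transpose (f : MatFun F a b) : mInv f.transpose = (mInv f).transpose := rfl

end operatorMatrices

/-! ### Differential operators, division by $D$ and the bilinear concomitant. -/

section differentialOperators

variable {Ω : TopologicalSpace.Opens Vars} {F : FunClass Ω} {a b e : ℕ}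

/-- Matrix differential operators `∑ w_j D^j` of order at most `k`. -/
def IsDiff (k : ℕ) (X : OpMat F a b) : Prop :=
  ∃ w : ℕ → MatFun F a b, X = ∑ j ∈ Finset.range (k + 1), em (w j) * opD F b ^ j

theorem IsDiff.zero (k : ℕ) : IsDiff k (0 : OpMat F a b) :=
  ⟨0, by simp [em_zero]⟩

theorem IsDiff.add {k : ℕ} {X Y : OpMat F a b} (hX : IsDiff k X) (hY : IsDiff k Y) :
    IsDiff k (X + Y) := by
  obtain ⟨w, rfl⟩ := hX
  obtain ⟨v, rfl⟩ := hY
  exact ⟨w + v, by simp only [Pi.add_apply, em_add, Matrix.add_mul, Finset.sum_add_distrib]⟩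

theorem IsDiff.neg {k : ℕ} {X : OpMat F a b} (hX : IsDiff k X) : IsDiff k (-X) := by
  obtain ⟨w, rfl⟩ := hX
  exact ⟨-w, by simp only [Pi.neg_apply, em_neg, Matrix.neg_mul, Finset.sum_neg_distrib]⟩

theorem IsDiff.sub {k : ℕ} {X Y : OpMat F a b} (hX : IsDiff k X) (hY : IsDiff k Y) :
    IsDiff k (X - Y) := by
  rw [sub_eq_add_neg]
  exact hX.add hY.neg

theorem IsDiff.sum {ι : Type*} {k : ℕ} {s : Finset ι} {X : ι → OpMat F a b}
    (h : ∀ i ∈ s, IsDiff k (X i)) : IsDiff k (∑ i ∈ s, X i) :=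
  Finset.sum_induction X (IsDiff k) (fun _ _ => IsDiff.add) (IsDiff.zero k) h

theorem IsDiff.monomial {j k : ℕ} (h : j ≤ k) (w : MatFun F a b) :
    IsDiff k (em w * opD F b ^ j) := by
  refine ⟨Pi.single j w, ?_⟩
  rw [Finset.sum_eq_single j]
  · rw [Pi.single_eq_same]
  · intro i _ hi
    rw [Pi.single_eq_of_ne hi, em_zero, Matrix.zero_mul]
  · intro hj
    exact absurd (Finset.mem_range.2 (Nat.lt_succ_of_le h)) hj

theorem IsDiff.em (k : ℕ) (w : MatFun F a b) : IsDiff k (em w) := by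
  have h := IsDiff.monomial (Nat.zero_le k) w
  rwa [pow_zero, Matrix.mul_one] at h

theorem IsDiff.mono {j k : ℕ} (h : j ≤ k) {X : OpMat F a b} (hX : IsDiff j X) : IsDiff k X := by
  obtain ⟨w, rfl⟩ := hX
  exact IsDiff.sum fun i hi =>
    IsDiff.monomial ((Nat.lt_succ_iff.1 (Finset.mem_range.1 hi)).trans h) _

theorem IsDiff.em_mul {k : ℕ} (g : MatFun F e a) {X : OpMat F a b} (hX : IsDiff k X) :
    IsDiff k (BDKP.em g * X) := by
  obtain ⟨w, rfl⟩ := hX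
  rw [Matrix.mul_sum]
  refine IsDiff.sum fun i hi => ?_
  rw [← Matrix.mul_assoc, ← BDKP.em_mul]
  exact IsDiff.monomial (Nat.lt_succ_iff.1 (Finset.mem_range.1 hi)) _

theorem IsDiff.mul_opD {k : ℕ} {X : OpMat F a b} (hX : IsDiff k X) :
    IsDiff (k + 1) (X * opD F b) := by
  obtain ⟨w, rfl⟩ := hX
  rw [Matrix.sum_mul]
  refine IsDiff.sum fun i hi => ?_
  rw [Matrix.mul_assoc, ← pow_succ]
  exact IsDiff.monomial (Nat.succ_le_of_lt (Finset.mem_range.1 hi)) _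

theorem IsDiff.opD_mul {k : ℕ} {X : OpMat F a b} (hX : IsDiff k X) :
    IsDiff (k + 1) (opD F a * X) := by
  obtain ⟨w, rfl⟩ := hX
  rw [Matrix.mul_sum]
  refine IsDiff.sum fun i hi => ?_
  rw [← Matrix.mul_assoc, opD_mul_em, Matrix.add_mul, Matrix.mul_assoc, ← pow_succ']
  exact (IsDiff.monomial (Nat.succ_le_of_lt (Finset.mem_range.1 hi)) _).add
    (IsDiff.monomial (Finset.mem_range.1 hi).le _)

theorem IsDiff.mul_em {k : ℕ} {X : OpMat F a b} (hX : IsDiff k X) (g : MatFun F b e) :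
    IsDiff k (X * BDKP.em g) := by
  -- Moving $D^j$ to the right past a function does not raise the order.
  have h (j : ℕ) : IsDiff j (opD F b ^ j * BDKP.em g) := by
    induction j with
    | zero => rw [pow_zero, Matrix.one_mul]; exact IsDiff.em 0 g
    | succ j ih => rw [pow_succ', Matrix.mul_assoc]; exact ih.opD_mul
  obtain ⟨w, rfl⟩ := hX
  rw [Matrix.sum_mul]
  refine IsDiff.sum fun i hi => ?_
  rw [Matrix.mul_assoc]
  exact ((h i).mono (Nat.lt_succ_iff.1 (Finset.mem_range.1 hi))).em_mul _

/-- `h D^j = D V + (-1)^j h^{(j)}`. -/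
theorem em_mul_opD_pow (j : ℕ) (h : MatFun F a b) :
    ∃ V : OpMat F a b, IsDiff j V ∧
      em h * opD F b ^ j = opD F a * V + em ((-1 : ℂ) ^ j • mX^[j] h) := by
  induction j with
  | zero =>
    refine ⟨0, IsDiff.zero 0, ?_⟩
    rw [pow_zero, pow_zero, one_smul, Matrix.mul_one, Matrix.mul_zero, zero_add,
      Function.iterate_zero_apply]
  | succ j ih =>
    obtain ⟨V, hV, h1⟩ := ih
    -- With $h_j=(-1)^jh^{(j)}$, one has $(DV+h_j)D=D(VD+h_j)-h_j'$.
    refine ⟨V * opD F b + em ((-1 : ℂ) ^ j • mX^[j] h),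
      hV.mul_opD.add (IsDiff.em _ _), ?_⟩
    have h2 := opD_mul_em ((-1 : ℂ) ^ j • mX^[j] h)
    rw [pow_succ, ← Matrix.mul_assoc, h1, Matrix.mul_add, h2, Matrix.add_mul,
      Function.iterate_succ_apply', pow_succ, mul_neg_one, neg_smul, em_neg, mX_smul,
      Matrix.mul_assoc]
    abel

/-- `D^j g = g^{(j)} + P D`, and the bilinear concomitant `B` of `D^j`. -/
theorem opD_pow_mul_em (j : ℕ) (g : MatFun F a b) :
    ∃ P : OpMat F a b, IsDiff j P ∧ opD F a ^ j * em g = em (mX^[j] g) + P * opD F b ∧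
      ∀ (n : ℕ) (h : MatFun F n a), ∃ (V : OpMat F n b) (B : MatFun F n b), IsDiff j V ∧
        em h * P = opD F n * V + em B ∧
        (InJ h → InJ B) ∧ mX B = h * mX^[j] g - (-1 : ℂ) ^ j • mX^[j] h * g := by
  induction j with
  | zero =>
    refine ⟨0, IsDiff.zero 0, ?_, fun n h => ⟨0, 0, IsDiff.zero 0, ?_, fun _ => InJ.zero, ?_⟩⟩
    · rw [pow_zero, Matrix.one_mul, Matrix.zero_mul, add_zero, Function.iterate_zero_apply]
    · rw [Matrix.mul_zero, Matrix.mul_zero, em_zero, add_zero]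
    · rw [pow_zero, one_smul, mX_zero, Function.iterate_zero_apply, Function.iterate_zero_apply,
        sub_self]
  | succ j ih =>
    obtain ⟨P, hP, h1, h2⟩ := ih
    -- From $D(g^{(j)}+PD)=g^{(j+1)}+(g^{(j)}+DP)D$.
    refine ⟨em (mX^[j] g) + opD F a * P, (IsDiff.em _ _).add hP.opD_mul, ?_, fun n h => ?_⟩
    · rw [pow_succ', Matrix.mul_assoc, h1, Matrix.mul_add, opD_mul_em, Matrix.add_mul,
        Function.iterate_succ_apply', Matrix.mul_assoc]
      abel
    · obtain ⟨V, B, hV, h3, hB, h4⟩ := h2 n (mX h)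
      have h5 : em h * opD F a = opD F n * em h - em (mX h) :=
        eq_sub_of_add_eq (opD_mul_em h).symm
      -- Since $hD=Dh-h'$, the induction hypothesis is applied to $h'$ and its `V` and `B` enter
      -- with a minus sign.
      refine ⟨em h * P - V, h * mX^[j] g - B, (hP.em_mul h).sub hV |>.mono j.le_succ, ?_,
        fun hh => (hh.mul_right _).sub (hB hh.mX), ?_⟩
      · rw [Matrix.mul_add, ← Matrix.mul_assoc, h5, Matrix.sub_mul, h3, Matrix.mul_sub, em_sub,
          em_mul, Matrix.mul_assoc]
        abel
      · rw [mX_sub, mX_mul, h4, Function.iterate_succ_apply', pow_succ, mul_neg_one, neg_smul,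
          Matrix.neg_mul, Function.iterate_succ_apply]
        abel

/-- The operator `∑ u_j D^j`. -/
def diffR (k : ℕ) (u : ℕ → MatFun F a a) : OpMat F a a :=
  ∑ j ∈ Finset.range (k + 1), em (u j) * opD F a ^ j

/-- Left division by $D$: the remainder is the transpose acting on $h^\top$. In $W\sum u_jD^j$ the
quotient absorbs the $D^{-1}$ of $W$, so only the remainder stays nonlocal. -/
theorem em_mul_diffR (k : ℕ) (u : ℕ → MatFun F a a) (h : MatFun F b a) :
    ∃ V : OpMat F b a, IsDiff k V ∧
      em h * diffR k u = opD F b * V + em (diffOpT k u h.transpose).transpose := by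
  choose V hV h1 using fun j => em_mul_opD_pow j (h * u j)
  refine ⟨∑ j ∈ Finset.range (k + 1), V j, IsDiff.sum fun j hj =>
    (hV j).mono (Nat.lt_succ_iff.1 (Finset.mem_range.1 hj)), ?_⟩
  rw [diffR, diffOpT, Matrix.mul_sum, Matrix.mul_sum, Matrix.transpose_sum, em_sum,
    ← Finset.sum_add_distrib]
  refine Finset.sum_congr rfl fun j _ => ?_
  rw [← Matrix.mul_assoc, ← em_mul, h1, ← Matrix.transpose_mul, mX_iterate_transpose,
    Matrix.transpose_smul, Matrix.transpose_transpose]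

/-- Right division by $D$, followed by left division of $hP$. The second remainder is the boundary
term of Lagrange's identity, hence the formula for its derivative; with $g=\varphi$ and
$h=\psi^\top$ it is the $E$ of `Dresses`. -/
theorem diffR_mul_em (k : ℕ) (u : ℕ → MatFun F a a) (g : MatFun F a b) :
    ∃ P : OpMat F a b, IsDiff k P ∧ diffR k u * em g = em (diffOp k u g) + P * opD F b ∧
      ∀ (n : ℕ) (h : MatFun F n a), ∃ (V : OpMat F n b) (B : MatFun F n b), IsDiff k V ∧
        em h * P = opD F n * V + em B ∧
        (InJ h → InJ B) ∧
        mX B = h * diffOp k u g - (diffOpT k u h.transpose).transpose * g := by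
  choose P hP h1 h2 using fun j => opD_pow_mul_em j g
  have hle {j : ℕ} (hj : j ∈ Finset.range (k + 1)) : j ≤ k :=
    Nat.lt_succ_iff.1 (Finset.mem_range.1 hj)
  refine ⟨∑ j ∈ Finset.range (k + 1), em (u j) * P j, IsDiff.sum fun j hj =>
    ((hP j).mono (hle hj)).em_mul _, ?_, fun n h => ?_⟩
  · rw [diffR, diffOp, Matrix.sum_mul, em_sum, Matrix.sum_mul, ← Finset.sum_add_distrib]
    refine Finset.sum_congr rfl fun j _ => ?_
    rw [Matrix.mul_assoc, h1, Matrix.mul_add, em_mul, Matrix.mul_assoc]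
  · choose V B hV h3 hB h4 using fun j => h2 j n (h * u j)
    refine ⟨∑ j ∈ Finset.range (k + 1), V j, ∑ j ∈ Finset.range (k + 1), B j,
      IsDiff.sum fun j hj => (hV j).mono (hle hj), ?_,
      fun hh => InJ.sum fun j _ => hB j (hh.mul_right _), ?_⟩
    · rw [Matrix.mul_sum, Matrix.mul_sum, em_sum, ← Finset.sum_add_distrib]
      refine Finset.sum_congr rfl fun j _ => ?_
      rw [← Matrix.mul_assoc, ← em_mul, h3]
    · rw [mX_sum, diffOp, diffOpT, Matrix.mul_sum, Matrix.transpose_sum, Matrix.sum_mul,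
        ← Finset.sum_sub_distrib]
      refine Finset.sum_congr rfl fun j _ => ?_
      rw [h4, Matrix.mul_assoc, ← Matrix.transpose_mul, mX_iterate_transpose,
        Matrix.transpose_smul, Matrix.transpose_transpose]

end differentialOperators

/-! ### Conjugation by $W$. -/

section dressing

variable {Ω : TopologicalSpace.Opens Vars} {F : FunClass Ω} {N K m a b : ℕ}

theorem opI_em_opI {f : MatFun F a b} (hf : InJ f) :
    opI F a * em f * opI F b = em (mInv f) * opI F b - opI F a * em (mInv f) := by
  have h := opI_mul_em_mul_opI (mInv f)
  rwa [mX_mInv hf] at h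

theorem mX_Δ (B : DarbouxData F N K) (hφ : InJ B.φ) :
    mX B.Δ = B.ψ.transpose * B.φ := by
  rw [DarbouxData.Δ, mX_add, mX_const, zero_add, mX_mInv (hφ.mul_left _)]

theorem Δ_mul_inv {B : DarbouxData F N K} (hΔ : IsUnit B.Δ) : B.Δ * B.Δ⁻¹ = 1 :=
  Matrix.mul_nonsing_inv _ ((Matrix.isUnit_iff_isUnit_det _).1 hΔ)

theorem inv_mul_Δ {B : DarbouxData F N K} (hΔ : IsUnit B.Δ) : B.Δ⁻¹ * B.Δ = 1 :=
  Matrix.nonsing_inv_mul _ ((Matrix.isUnit_iff_isUnit_det _).1 hΔ)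

/-- The matrix `Δ⁻¹ ψᵀ`. -/
def rowΨ (B : DarbouxData F N K) : MatFun F K N := B.Δ⁻¹ * B.ψ.transpose

/-- The operator `W`. -/
def WR (B : DarbouxData F N K) : OpMat F N N :=
  1 - em (B.φ * B.Δ⁻¹) * opI F K * em B.ψ.transpose

/-- The operator `W⁻¹`. -/
def WiR (B : DarbouxData F N K) : OpMat F N N :=
  1 + em B.φ * opI F K * em (rowΨ B)

theorem Δ_mul_rowΨ {B : DarbouxData F N K} (hΔ : IsUnit B.Δ) :
    B.Δ * rowΨ B = B.ψ.transpose := by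
  rw [rowΨ, ← Matrix.mul_assoc, Δ_mul_inv hΔ, Matrix.one_mul]

/-- Integration by parts applied to $\psi^\top g=(D^{-1}\{\psi^\top g\})'$; the function in front of
$D^{-1}$ on the right is $W\{g\}$. -/
theorem WR_mul_em_mul_opI (B : DarbouxData F N K) {g : MatFun F N m} (hg : InJ g) :
    WR B * em g * opI F m =
      em (g - B.φ * B.Δ⁻¹ * mInv (B.ψ.transpose * g)) * opI F m
        + em (B.φ * B.Δ⁻¹) * opI F K * em (mInv (B.ψ.transpose * g)) := by
  have h := congrArg (em (B.φ * B.Δ⁻¹) * ·) (opI_em_opI (hg.mul_left B.ψ.transpose))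
  simp only [em_mul, Matrix.mul_sub, Matrix.mul_assoc] at h
  simp only [WR, Matrix.sub_mul, Matrix.one_mul, em_sub, em_mul, Matrix.mul_assoc, h]
  abel

theorem opI_em_Δ (B : DarbouxData F N K) (hφ : InJ B.φ) :
    opI F K * em (B.ψ.transpose * B.φ) * opI F K = em B.Δ * opI F K - opI F K * em B.Δ := by
  rw [← mX_Δ B hφ, opI_mul_em_mul_opI]

/-- Here $D^{-1}\psi^\top\varphi D^{-1}=\Delta D^{-1}-D^{-1}\Delta$, and $\varphi\Delta^{-1}\Delta
D^{-1}$ cancels the leading $\varphi D^{-1}$. -/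
theorem WR_mul_φ {B : DarbouxData F N K} (hφ : InJ B.φ) (hΔ : IsUnit B.Δ) :
    WR B * em B.φ * opI F K = em (B.φ * B.Δ⁻¹) * opI F K * em B.Δ := by
  have h := congrArg (em (B.φ * B.Δ⁻¹) * ·) (opI_em_Δ B hφ)
  have h2 : em B.φ * (em B.Δ⁻¹ * (em B.Δ * opI F K)) = em B.φ * opI F K := by
    rw [← Matrix.mul_assoc (em B.Δ⁻¹), ← em_mul, inv_mul_Δ hΔ, em_one, Matrix.one_mul]
  simp only [em_mul, Matrix.mul_sub, Matrix.mul_assoc] at h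
  simp only [WR, Matrix.sub_mul, Matrix.one_mul, em_mul, Matrix.mul_assoc, h, h2]
  abel

theorem WR_mul_WiR {B : DarbouxData F N K} (hφ : InJ B.φ) (hΔ : IsUnit B.Δ) :
    WR B * WiR B = 1 := by
  have h := congrArg (· * em (rowΨ B)) (WR_mul_φ hφ hΔ)
  simp only [Matrix.mul_assoc, ← em_mul, Δ_mul_rowΨ hΔ] at h
  rw [WiR, Matrix.mul_add, Matrix.mul_one]
  simp only [Matrix.mul_assoc]
  rw [h, WR, Matrix.mul_assoc]
  abel

/-- Differentiate $\Delta^{-1}\Delta=1$. -/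
theorem mX_Δ_inv {B : DarbouxData F N K} (hφ : InJ B.φ) (hΔ : IsUnit B.Δ) :
    mX B.Δ⁻¹ = -(rowΨ B * (B.φ * B.Δ⁻¹)) := by
  have h : mX (B.Δ⁻¹ * B.Δ) = 0 := by
    rw [inv_mul_Δ hΔ]
    have h1 := mX_const (F := F) (1 : Matrix (Fin K) (Fin K) ℂ)
    rwa [const, Matrix.map_one _ (map_zero _) (map_one _)] at h1
  rw [mX_mul, mX_Δ B hφ] at h
  have h2 := congrArg (· * B.Δ⁻¹) (eq_neg_of_add_eq_zero_left h)
  simp only [Matrix.mul_assoc, Δ_mul_inv hΔ, Matrix.mul_one, Matrix.neg_mul] at h2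
  rw [h2, rowΨ]
  simp only [Matrix.mul_assoc]

/-- A one-sided inverse does not suffice in this noncommutative ring. This side is integration by
parts for $\Delta^{-1}$ in place of $\Delta$. -/
theorem WiR_mul_WR {B : DarbouxData F N K} (hφ : InJ B.φ) (hΔ : IsUnit B.Δ) :
    WiR B * WR B = 1 := by
  have h := opI_mul_em_mul_opI B.Δ⁻¹
  rw [mX_Δ_inv hφ hΔ, em_neg, Matrix.mul_neg, Matrix.neg_mul, neg_eq_iff_eq_neg] at h
  have h2 := congrArg (fun X => em B.φ * X * em B.ψ.transpose) h
  simp only [em_mul, Matrix.mul_sub, Matrix.sub_mul, Matrix.mul_neg, Matrix.neg_mul,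
    Matrix.mul_assoc] at h2
  rw [WR, WiR]
  simp only [Matrix.mul_sub, Matrix.add_mul, Matrix.one_mul, Matrix.mul_one, em_mul,
    Matrix.mul_assoc]
  rw [h2]
  simp only [rowΨ, em_mul]
  abel

/-- The effect of conjugation by `W` on an operator `Y`, up to the nonlocal terms that combine when
the contributions to `Y{φ}` and `Y^τ{ψ}ᵀ` are added. -/
structure Dresses (B : DarbouxData F N K) (Y Y' : OpMat F N N) (f : MatFun F N K)
    (ρ : MatFun F K N) : Prop where
  exists_eq : ∃ E : MatFun F K K, InJ E ∧ mX E = B.ψ.transpose * f - ρ * B.φ ∧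
    WR B * Y * WiR B = Y' + WR B * em f * opI F K * em (rowΨ B)
      - em (B.φ * B.Δ⁻¹) * opI F K * em (ρ + E * rowΨ B)

/-- Both equations of `Dresses` are jointly linear in $Y,Y',f,\rho,E$. -/
theorem Dresses.add {B : DarbouxData F N K} {Y Y' Z Z' : OpMat F N N} {f g : MatFun F N K}
    {ρ σ : MatFun F K N} (hY : Dresses B Y Y' f ρ) (hZ : Dresses B Z Z' g σ) :
    Dresses B (Y + Z) (Y' + Z') (f + g) (ρ + σ) := by
  obtain ⟨E, hE, hXE, h⟩ := hY
  obtain ⟨G, hG, hXG, h'⟩ := hZ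
  refine ⟨E + G, hE.add hG, ?_, ?_⟩
  · rw [mX_add, hXE, hXG, Matrix.mul_add, Matrix.add_mul]
    abel
  · rw [Matrix.mul_add, Matrix.add_mul, h, h']
    simp only [em_add, Matrix.mul_add, Matrix.add_mul]
    abel

theorem Dresses.neg {B : DarbouxData F N K} {Y Y' : OpMat F N N} {f : MatFun F N K}
    {ρ : MatFun F K N} (hY : Dresses B Y Y' f ρ) : Dresses B (-Y) (-Y') (-f) (-ρ) := by
  obtain ⟨E, hE, hXE, h⟩ := hY
  refine ⟨-E, hE.neg, ?_, ?_⟩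
  · rw [mX_neg, hXE, Matrix.mul_neg, Matrix.neg_mul]
    abel
  · rw [Matrix.mul_neg, Matrix.neg_mul, h]
    simp only [em_add, em_neg, Matrix.mul_add, Matrix.mul_neg, Matrix.neg_mul]
    abel

theorem Dresses.smul (z : ℂ) {B : DarbouxData F N K} {Y Y' : OpMat F N N} {f : MatFun F N K}
    {ρ : MatFun F K N} (hY : Dresses B Y Y' f ρ) :
    Dresses B (z • Y) (z • Y') (z • f) (z • ρ) := by
  obtain ⟨E, hE, hXE, h⟩ := hY
  refine ⟨z • E, hE.smul z, ?_, ?_⟩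
  · rw [mX_smul, hXE, Matrix.mul_smul, Matrix.smul_mul, smul_sub]
  · rw [Matrix.mul_smul, Matrix.smul_mul, h, Matrix.smul_mul, ← smul_add, em_smul, em_smul]
    simp only [Matrix.mul_smul, Matrix.smul_mul, smul_sub, smul_add]

theorem Dresses.sub {B : DarbouxData F N K} {Y Y' Z Z' : OpMat F N N} {f g : MatFun F N K}
    {ρ σ : MatFun F K N} (hY : Dresses B Y Y' f ρ) (hZ : Dresses B Z Z' g σ) :
    Dresses B (Y - Z) (Y' - Z') (f - g) (ρ - σ) := by
  simp only [sub_eq_add_neg]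
  exact hY.add hZ.neg

theorem Dresses.zero (B : DarbouxData F N K) : Dresses B 0 0 0 0 := by
  refine ⟨0, InJ.zero, ?_, ?_⟩
  · simp [mX_zero]
  · simp [em_zero]

theorem Dresses.sum {ι : Type*} {B : DarbouxData F N K} {s : Finset ι} {Y Y' : ι → OpMat F N N}
    {f : ι → MatFun F N K} {ρ : ι → MatFun F K N}
    (h : ∀ i ∈ s, Dresses B (Y i) (Y' i) (f i) (ρ i)) :
    Dresses B (∑ i ∈ s, Y i) (∑ i ∈ s, Y' i) (∑ i ∈ s, f i) (∑ i ∈ s, ρ i) := by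
  classical
  induction s using Finset.induction_on with
  | empty => simpa using Dresses.zero B
  | insert i s hi ih =>
    simp only [Finset.sum_insert hi]
    exact (h i (Finset.mem_insert_self i s)).add
      (ih fun j hj => h j (Finset.mem_insert_of_mem hj))

/-- The dressing of a derivation. -/
theorem Dresses.derivation {B : DarbouxData F N K} (hφ : InJ B.φ) (hΔ : IsUnit B.Δ)
    (δ : JDerivation F) :
    Dresses B (sc F N (derOp δ)) (sc F N (derOp δ)) (δ.mat B.φ) (-δ.mat B.ψ).transpose := by
  change Dresses B _ _ _ (-δ.mat B.ψ.transpose)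
  have hE : InJ (mInv (B.ψ.transpose * B.φ)) := (hφ.mul_left _).mInv
  have hΔδ : δ.mat B.Δ = δ.mat (mInv (B.ψ.transpose * B.φ)) := by
    rw [DarbouxData.Δ, mat_add, mat_const, zero_add]
  -- The witness is $E=\delta\Delta$. It lies in $J$, although $\Delta$ need not, because $\delta$
  -- kills the constant $C$.
  refine ⟨δ.mat B.Δ, hΔδ ▸ hE.mat δ, ?_, ?_⟩
  · rw [mX_mat, mX_Δ B hφ, mat_mul, Matrix.neg_mul]
    abel
  · set T := derOp δ
    have h1 : sc F N T * em B.φ = em B.φ * sc F K T + em (δ.mat B.φ) := derOp_mul_em δ _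
    have h2 : em B.Δ * sc F K T = sc F K T * em B.Δ - em (δ.mat B.Δ) :=
      eq_sub_of_add_eq (derOp_mul_em δ _).symm
    have h3 : em B.ψ.transpose * sc F N T = sc F K T * em B.ψ.transpose
        - em (δ.mat B.ψ.transpose) := eq_sub_of_add_eq (derOp_mul_em δ _).symm
    have h4 : sc F N T * WiR B = sc F N T + em (δ.mat B.φ) * opI F K * em (rowΨ B)
        + em B.φ * opI F K * (sc F K T * em (rowΨ B)) := by
      rw [WiR, Matrix.mul_add, Matrix.mul_one, ← Matrix.mul_assoc, ← Matrix.mul_assoc, h1,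
        Matrix.add_mul, Matrix.add_mul, Matrix.mul_assoc (em B.φ), derOp_mul_opI]
      simp only [Matrix.mul_assoc]
      abel
    have h5 : WR B * (em B.φ * opI F K * (sc F K T * em (rowΨ B))) =
        em (B.φ * B.Δ⁻¹) * opI F K * (sc F K T * em B.ψ.transpose)
          - em (B.φ * B.Δ⁻¹) * opI F K * em (δ.mat B.Δ * rowΨ B) := by
      rw [← Matrix.mul_assoc (WR B), ← Matrix.mul_assoc (WR B), WR_mul_φ hφ hΔ,
        ← Matrix.mul_assoc _ (sc F K T), Matrix.mul_assoc _ (em B.Δ), h2, Matrix.mul_sub,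
        Matrix.sub_mul, em_mul (δ.mat B.Δ),
        ← Δ_mul_rowΨ hΔ, em_mul B.Δ]
      simp only [Matrix.mul_assoc]
    have h6 : WR B * sc F N T = sc F N T
        - em (B.φ * B.Δ⁻¹) * opI F K * (sc F K T * em B.ψ.transpose)
        + em (B.φ * B.Δ⁻¹) * opI F K * em (δ.mat B.ψ.transpose) := by
      rw [WR, Matrix.sub_mul, Matrix.one_mul, Matrix.mul_assoc, h3, Matrix.mul_sub]
      abel
    rw [Matrix.mul_assoc, h4, Matrix.mul_add, Matrix.mul_add, h5, h6, em_add, em_neg,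
      Matrix.mul_add, Matrix.mul_neg]
    simp only [Matrix.mul_assoc]
    abel

/-- The dressing of an integral operator. -/
theorem Dresses.integral {B : DarbouxData F N K} (hφ : InJ B.φ)
    {g h : MatFun F N m} (hg : InJ g) :
    Dresses B (em g * opI F m * em h.transpose)
      (em (B.W g) * opI F m * em (B.WinvT h).transpose)
      (intOp g h B.φ) (intOpT g h B.ψ).transpose := by
  have hρ : (intOpT g h B.ψ).transpose = -(mInv (B.ψ.transpose * g) * h.transpose) := by
    rw [intOpT, Matrix.transpose_neg, Matrix.transpose_mul, ← mInv_transpose,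
      Matrix.transpose_mul, Matrix.transpose_transpose]
  have hW : (B.WinvT h).transpose = h.transpose - mInv (h.transpose * B.φ) * rowΨ B := by
    rw [DarbouxData.WinvT, intOpT, Matrix.transpose_add, Matrix.transpose_neg,
      Matrix.transpose_mul, ← mInv_transpose, Matrix.transpose_mul, Matrix.transpose_transpose,
      Matrix.transpose_mul, Matrix.transpose_transpose, ← sub_eq_add_neg, rowΨ]
  rw [hρ, hW, DarbouxData.W, intOp]
  have hQ : InJ (B.ψ.transpose * g) := hg.mul_left _
  have hR : InJ (h.transpose * B.φ) := hφ.mul_left _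
  set Q := mInv (B.ψ.transpose * g) with hQdef
  set R := mInv (h.transpose * B.φ) with hRdef
  -- Here $f=gR$ and $\rho=-Qh^\top$, so $(QR)'=\psi^\top gR+Qh^\top\varphi$ is the required
  -- derivative.
  refine ⟨Q * R, hQ.mInv.mul_right _, ?_, ?_⟩
  · rw [mX_mul, hQdef, hRdef, mX_mInv hQ, mX_mInv hR, intOp]
    simp only [Matrix.neg_mul, Matrix.mul_assoc]
    abel
  · have h1 : em g * opI F m * em h.transpose * WiR B =
        em g * opI F m * em (h.transpose - R * rowΨ B)
          + em (g * R) * opI F K * em (rowΨ B) := by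
      have h2 := congrArg (fun X => em g * X * em (rowΨ B)) (opI_em_opI hR)
      simp only [em_mul, Matrix.mul_sub, Matrix.sub_mul, Matrix.mul_assoc] at h2
      simp only [WiR, em_sub, em_mul, Matrix.mul_add, Matrix.mul_sub, Matrix.mul_one,
        Matrix.mul_assoc]
      rw [h2]
      abel
    rw [Matrix.mul_assoc, h1, Matrix.mul_add, ← Matrix.mul_assoc, ← Matrix.mul_assoc,
      WR_mul_em_mul_opI B hg, intOp]
    simp only [em_add, em_neg, em_sub, em_mul, Matrix.mul_add, Matrix.add_mul, Matrix.mul_sub,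
      Matrix.mul_neg, Matrix.mul_assoc]
    abel

/-- The dressing of a differential operator. -/
theorem Dresses.differential {B : DarbouxData F N K} (hψ : InJ B.ψ)
    (k : ℕ) (u : ℕ → MatFun F N N) :
    ∃ û : ℕ → MatFun F N N,
      Dresses B (diffR k u) (diffR k û) (diffOp k u B.φ) (diffOpT k u B.ψ).transpose := by
  obtain ⟨P, hP, h1, h2⟩ := diffR_mul_em k u B.φ
  obtain ⟨V', E, hV', h3, hE, hXE⟩ := h2 K B.ψ.transpose
  obtain ⟨V, hV, h4⟩ := em_mul_diffR k u B.ψ.transpose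
  rw [Matrix.transpose_transpose] at h4 hXE
  -- The new coefficients gather all terms of $WUW^{-1}$, $U=\sum u_jD^j$, in which a factor $D$ has
  -- cancelled every $D^{-1}$.
  obtain ⟨û, hû⟩ : IsDiff k (diffR k u + P * em (rowΨ B) - em (B.φ * B.Δ⁻¹) * V
      - em (B.φ * B.Δ⁻¹) * (V' * em (rowΨ B))) :=
    (((show IsDiff k (diffR k u) from ⟨u, rfl⟩).add (hP.mul_em _)).sub (hV.em_mul _)).sub
      ((hV'.mul_em _).em_mul _)
  refine ⟨û, E, hE hψ.transpose, hXE, ?_⟩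
  rw [show diffR k û = _ from hû.symm]
  have hDI {n : ℕ} (X : OpMat F K n) : opI F K * (opD F K * X) = X := by
    rw [← Matrix.mul_assoc, opI_mul_opD, Matrix.one_mul]
  have hID {n : ℕ} (X : OpMat F K n) : opD F K * (opI F K * X) = X := by
    rw [← Matrix.mul_assoc, opD_mul_opI, Matrix.one_mul]
  have h5 : diffR k u * WiR B = diffR k u + em (diffOp k u B.φ) * opI F K * em (rowΨ B)
      + P * em (rowΨ B) := by
    rw [WiR, Matrix.mul_add, Matrix.mul_one, ← Matrix.mul_assoc, ← Matrix.mul_assoc, h1,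
      Matrix.add_mul, Matrix.add_mul]
    simp only [Matrix.mul_assoc, hID]
    abel
  have h6 : WR B * diffR k u = diffR k u - em (B.φ * B.Δ⁻¹) * V
      - em (B.φ * B.Δ⁻¹) * opI F K * em (diffOpT k u B.ψ).transpose := by
    rw [WR, Matrix.sub_mul, Matrix.one_mul, Matrix.mul_assoc, h4, Matrix.mul_add,
      Matrix.mul_assoc _ (opI F K) (opD F K * V), hDI]
    abel
  have h7 : WR B * P = P - em (B.φ * B.Δ⁻¹) * V' - em (B.φ * B.Δ⁻¹) * opI F K * em E := by
    rw [WR, Matrix.sub_mul, Matrix.one_mul, Matrix.mul_assoc, h3, Matrix.mul_add,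
      Matrix.mul_assoc _ (opI F K) (opD F K * V'), hDI]
    abel
  rw [Matrix.mul_assoc, h5, Matrix.mul_add, Matrix.mul_add, h6, ← Matrix.mul_assoc _ P, h7,
    em_add, em_mul E]
  simp only [Matrix.sub_mul, Matrix.mul_add, Matrix.mul_assoc]
  abel

theorem const_mul {c : ℕ} (X : Matrix (Fin a) (Fin b) ℂ) (Y : Matrix (Fin b) (Fin c) ℂ) :
    const F (X * Y) = const F X * const F Y := Matrix.map_mul

theorem const_sub (X Y : Matrix (Fin a) (Fin b) ℂ) :
    const F (X - Y) = const F X - const F Y := Matrix.map_sub _ (map_sub _) _ _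

theorem const_one : const F (1 : Matrix (Fin a) (Fin a) ℂ) = 1 :=
  Matrix.map_one _ (map_zero _) (map_one _)

theorem const_transpose (X : Matrix (Fin a) (Fin b) ℂ) :
    const F X.transpose = (const F X).transpose := rfl

/-- If `φ` and `ψ` are eigenfunctions of `Y` and `Y^τ`, the nonlocal terms add up. -/
theorem Dresses.conj_eq {B : DarbouxData F N K} (hφ : InJ B.φ)
    (hΔ : IsUnit B.Δ) {Y Y' : OpMat F N N} {f : MatFun F N K} {ρ : MatFun F K N}
    (hY : Dresses B Y Y' f ρ) {S S' : Matrix (Fin K) (Fin K) ℂ} (hf : f = B.φ * const F S)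
    (hρ : ρ = (const F S').transpose * B.ψ.transpose) :
    WR B * Y * WiR B = Y' +
      em (B.φ * B.Δ⁻¹ * const F (B.C * S - S'.transpose * B.C)) * opI F K * em (rowΨ B) := by
  obtain ⟨E, hE, hXE, h⟩ := hY
  set G := mInv (B.ψ.transpose * B.φ) with hG
  have hGJ : InJ (B.ψ.transpose * B.φ) := hφ.mul_left _
  -- Both sides lie in $J$ and have derivative $\psi^\top\varphi S-S'^\top\psi^\top\varphi$.
  have hEG : E = G * const F S - (const F S').transpose * G := by
    refine mX_inj hE ((hGJ.mInv.mul_right _).sub (hGJ.mInv.mul_left _)) ?_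
    rw [hXE, mX_sub, mX_mul, mX_mul, mX_const, ← const_transpose, mX_const, hG, mX_mInv hGJ, hf,
      hρ]
    simp only [Matrix.mul_zero, Matrix.zero_mul, add_zero, zero_add, Matrix.mul_assoc,
      const_transpose]
  have hGΔ : G = B.Δ - const F B.C := by rw [DarbouxData.Δ, add_sub_cancel_left]
  have h1 : WR B * em f * opI F K * em (rowΨ B) =
      em (B.φ * B.Δ⁻¹) * opI F K * em (B.Δ * const F S * rowΨ B) := by
    rw [hf, em_mul, ← Matrix.mul_assoc, Matrix.mul_assoc _ (em (const F S)), ← opI_mul_const,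
      ← Matrix.mul_assoc, WR_mul_φ hφ hΔ]
    simp only [em_mul, Matrix.mul_assoc]
  have h2 : em (B.φ * B.Δ⁻¹ * const F (B.C * S - S'.transpose * B.C)) * opI F K * em (rowΨ B) =
      em (B.φ * B.Δ⁻¹) * opI F K *
        em (const F (B.C * S - S'.transpose * B.C) * rowΨ B) := by
    rw [em_mul, Matrix.mul_assoc _ _ (opI F K), ← opI_mul_const, em_mul (const F _)]
    simp only [Matrix.mul_assoc]
  rw [h, h1, h2, add_sub_assoc, ← Matrix.mul_sub, ← em_sub]
  congr 4
  -- After $\psi^\top=\Delta(\Delta^{-1}\psi^\top)$ and $G=\Delta-C$, all terms containing $\Delta$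
  -- cancel and $CS-S'^\top C$ remains.
  rw [hρ, hEG, hGΔ, ← Δ_mul_rowΨ hΔ, const_sub, const_mul, const_mul, const_transpose]
  simp only [Matrix.sub_mul, Matrix.mul_sub, Matrix.mul_assoc]
  abel

end dressing

/-! ### From operator matrices back to actions on functions. -/

section representation

variable {Ω : TopologicalSpace.Opens Vars} {F : FunClass Ω} {a b e p : ℕ}

/-- The operator on `J`. -/
def OpRing.fst (x : OpRing F) : Module.End ℂ F.J := Prod.fst x

/-- The transposed operator on `J`. -/
def OpRing.snd (x : OpRing F) : Module.End ℂ F.J := MulOpposite.unop (Prod.snd x)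

/-- A matrix with entries in `J` as a matrix function. -/
def up (g : Matrix (Fin a) (Fin p) F.J) : MatFun F a p := g.map (↑)

/-- The action of a matrix of operators. -/
def act (X : OpMat F a b) (g : Matrix (Fin b) (Fin p) F.J) : Matrix (Fin a) (Fin p) F.J :=
  Matrix.of fun i q => ∑ j, (X i j).fst (g j q)

/-- The action of the transpose of a matrix of operators. -/
def actT (X : OpMat F a b) (g : Matrix (Fin a) (Fin p) F.J) : Matrix (Fin b) (Fin p) F.J :=
  Matrix.of fun j q => ∑ i, (X i j).snd (g i q)

theorem InJ.exists_up {f : MatFun F a p} (hf : InJ f) : ∃ g, f = up g :=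
  ⟨Matrix.of fun i j => ⟨f i j, hf i j⟩, rfl⟩

theorem InJ_up (g : Matrix (Fin a) (Fin p) F.J) : InJ (up g) := fun i j => (g i j).2

theorem up_mul_const (y : Matrix (Fin a) (Fin p) F.J) (S : Matrix (Fin p) (Fin e) ℂ) :
    up y * const F S = up (Matrix.of fun i q => ∑ k, S k q • y i k) := by
  ext i q : 1
  change _ = F.J.subtype (∑ k, S k q • y i k)
  rw [map_sum, Matrix.mul_apply]
  refine Finset.sum_congr rfl fun k _ => ?_
  change (y i k : F.carrier) * algebraMap ℂ F.carrier (S k q) = S k q • (y i k : F.carrier)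
  rw [Algebra.smul_def, mul_comm]

theorem act_add (X Y : OpMat F a b) (g : Matrix (Fin b) (Fin p) F.J) :
    act (X + Y) g = act X g + act Y g := by
  ext i q : 1
  change ∑ j, ((X i j).fst (g j q) + (Y i j).fst (g j q)) =
    ∑ j, (X i j).fst (g j q) + ∑ j, (Y i j).fst (g j q)
  exact Finset.sum_add_distrib ..

theorem actT_add (X Y : OpMat F a b) (g : Matrix (Fin a) (Fin p) F.J) :
    actT (X + Y) g = actT X g + actT Y g := by
  ext i q : 1
  change ∑ j, ((X j i).snd (g j q) + (Y j i).snd (g j q)) =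
    ∑ j, (X j i).snd (g j q) + ∑ j, (Y j i).snd (g j q)
  exact Finset.sum_add_distrib ..

theorem act_smul (z : ℂ) (X : OpMat F a b) (g : Matrix (Fin b) (Fin p) F.J) :
    act (z • X) g = z • act X g := by
  ext i q : 1
  change ∑ j, z • (X i j).fst (g j q) = z • ∑ j, (X i j).fst (g j q)
  exact (Finset.smul_sum ..).symm

theorem actT_smul (z : ℂ) (X : OpMat F a b) (g : Matrix (Fin a) (Fin p) F.J) :
    actT (z • X) g = z • actT X g := by
  ext i q : 1
  change ∑ j, z • (X j i).snd (g j q) = z • ∑ j, (X j i).snd (g j q)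
  exact (Finset.smul_sum ..).symm

theorem OpRing.fst_sum {ι : Type*} (s : Finset ι) (x : ι → OpRing F) (f : F.J) :
    (∑ i ∈ s, x i).fst f = ∑ i ∈ s, (x i).fst f := by
  let φ : OpRing F →+ F.J :=
    { toFun := fun x => x.fst f, map_zero' := rfl, map_add' := fun _ _ => rfl }
  exact map_sum φ x s

theorem OpRing.snd_sum {ι : Type*} (s : Finset ι) (x : ι → OpRing F) (f : F.J) :
    (∑ i ∈ s, x i).snd f = ∑ i ∈ s, (x i).snd f := by
  let φ : OpRing F →+ F.J :=
    { toFun := fun x => x.snd f, map_zero' := rfl, map_add' := fun _ _ => rfl }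
  exact map_sum φ x s

theorem act_mul (X : OpMat F a b) (Y : OpMat F b e) (g : Matrix (Fin e) (Fin p) F.J) :
    act (X * Y) g = act X (act Y g) := by
  ext i q : 1
  change ∑ k, ((X * Y) i k).fst (g k q) = ∑ j, (X i j).fst (∑ k, (Y j k).fst (g k q))
  simp only [Matrix.mul_apply, OpRing.fst_sum, map_sum]
  exact Finset.sum_comm

theorem actT_mul (X : OpMat F a b) (Y : OpMat F b e) (g : Matrix (Fin a) (Fin p) F.J) :
    actT (X * Y) g = actT Y (actT X g) := by
  ext k q : 1
  change ∑ i, ((X * Y) i k).snd (g i q) = ∑ j, (Y j k).snd (∑ i, (X i j).snd (g i q))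
  simp only [Matrix.mul_apply, OpRing.snd_sum, map_sum]
  exact Finset.sum_comm

theorem act_sc (x : OpRing F) (g : Matrix (Fin a) (Fin p) F.J) :
    act (sc F a x) g = g.map x.fst := by
  ext i q : 1
  change ∑ j, (sc F a x i j).fst (g j q) = x.fst (g i q)
  rw [Finset.sum_eq_single i]
  · rw [sc, Matrix.diagonal_apply_eq]
  · intro j _ hj
    rw [sc, Matrix.diagonal_apply_ne _ hj.symm]
    rfl
  · simp

theorem actT_sc (x : OpRing F) (g : Matrix (Fin a) (Fin p) F.J) :
    actT (sc F a x) g = g.map x.snd := by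
  ext i q : 1
  change ∑ j, (sc F a x j i).snd (g j q) = x.snd (g i q)
  rw [Finset.sum_eq_single i]
  · rw [sc, Matrix.diagonal_apply_eq]
  · intro j _ hj
    rw [sc, Matrix.diagonal_apply_ne _ hj]
    rfl
  · simp

/-- On matrix functions with `p` columns and entries in `J`, the matrix of operators `X` acts as
`f`, and its transpose acts as `fT`. -/
structure Rep (p : ℕ) (X : OpMat F a b) (f : MatFun F b p → MatFun F a p)
    (fT : MatFun F a p → MatFun F b p) : Prop where
  apply : ∀ g, f (up g) = up (act X g)
  applyT : ∀ g, fT (up g) = up (actT X g)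

section

variable {X Y : OpMat F a b} {f g : MatFun F b p → MatFun F a p}
  {fT gT : MatFun F a p → MatFun F b p}

theorem Rep.congr (h : Rep p X f fT) (hf : ∀ x, InJ x → g x = f x)
    (hT : ∀ x, InJ x → gT x = fT x) : Rep p X g gT :=
  ⟨fun x => (hf _ (InJ_up x)).trans (h.apply x), fun x => (hT _ (InJ_up x)).trans (h.applyT x)⟩

/-- The transfer principle: after rewriting `X` by an operator identity, two representations of the
same matrix act equally on $J$. `Rep.uniqueT` is the same for transposes. -/
theorem Rep.unique (h : Rep p X f fT) (h' : Rep p X g gT) {x : MatFun F b p} (hx : InJ x) :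
    f x = g x := by
  obtain ⟨x, rfl⟩ := hx.exists_up
  rw [h.apply, h'.apply]

theorem Rep.uniqueT (h : Rep p X f fT) (h' : Rep p X g gT) {x : MatFun F a p} (hx : InJ x) :
    fT x = gT x := by
  obtain ⟨x, rfl⟩ := hx.exists_up
  rw [h.applyT, h'.applyT]

theorem Rep.inJ (h : Rep p X f fT) {x : MatFun F b p} (hx : InJ x) : InJ (f x) := by
  obtain ⟨x, rfl⟩ := hx.exists_up
  rw [h.apply]
  exact InJ_up _

theorem Rep.inJT (h : Rep p X f fT) {x : MatFun F a p} (hx : InJ x) : InJ (fT x) := by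
  obtain ⟨x, rfl⟩ := hx.exists_up
  rw [h.applyT]
  exact InJ_up _

theorem Rep.add (h : Rep p X f fT) (h' : Rep p Y g gT) :
    Rep p (X + Y) (fun x => f x + g x) (fun x => fT x + gT x) :=
  ⟨fun x => by rw [h.apply, h'.apply, act_add]; rfl,
    fun x => by rw [h.applyT, h'.applyT, actT_add]; rfl⟩

theorem Rep.smul (z : ℂ) (h : Rep p X f fT) :
    Rep p (z • X) (fun x => z • f x) (fun x => z • fT x) :=
  ⟨fun x => by rw [h.apply, act_smul]; rfl, fun x => by rw [h.applyT, actT_smul]; rfl⟩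

theorem Rep.sub (h : Rep p X f fT) (h' : Rep p Y g gT) :
    Rep p (X - Y) (fun x => f x - g x) (fun x => fT x - gT x) := by
  have hs := h.add (h'.smul (-1))
  simp only [neg_smul, one_smul, ← sub_eq_add_neg] at hs
  exact hs

theorem Rep.zero : Rep p (0 : OpMat F a b) (fun _ => 0) (fun _ => 0) := by
  refine ⟨fun x => ?_, fun x => ?_⟩
  · ext i q : 1
    change (0 : F.carrier) = ↑(∑ j : Fin b, (0 : F.J))
    rw [Finset.sum_const_zero]; rfl
  · ext i q : 1
    change (0 : F.carrier) = ↑(∑ j : Fin a, (0 : F.J))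
    rw [Finset.sum_const_zero]; rfl

theorem Rep.sum {ι : Type*} (s : Finset ι) {X : ι → OpMat F a b}
    {f : ι → MatFun F b p → MatFun F a p} {fT : ι → MatFun F a p → MatFun F b p}
    (h : ∀ i, Rep p (X i) (f i) (fT i)) :
    Rep p (∑ i ∈ s, X i) (fun x => ∑ i ∈ s, f i x) (fun x => ∑ i ∈ s, fT i x) := by
  classical
  induction s using Finset.induction_on with
  | empty => exact Rep.zero
  | insert i s hi ih =>
    simp only [Finset.sum_insert hi]
    exact (h i).add ih

end

theorem Rep.mul {X : OpMat F a b} {Y : OpMat F b e} {f : MatFun F b p → MatFun F a p}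
    {fT : MatFun F a p → MatFun F b p} {g : MatFun F e p → MatFun F b p}
    {gT : MatFun F b p → MatFun F e p} (h : Rep p X f fT) (h' : Rep p Y g gT) :
    Rep p (X * Y) (fun x => f (g x)) (fun x => gT (fT x)) :=
  ⟨fun x => by rw [h'.apply, h.apply, act_mul], fun x => by rw [h.applyT, h'.applyT, actT_mul]⟩

theorem Rep.one : Rep p (1 : OpMat F a a) (fun x => x) (fun x => x) := by
  rw [← sc_one]
  exact ⟨fun x => by rw [act_sc]; rfl, fun x => by rw [actT_sc]; rfl⟩

theorem Rep.em (w : MatFun F a b) :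
    Rep p (em w) (fun x => w * x) (fun x => w.transpose * x) := by
  refine ⟨fun x => ?_, fun x => ?_⟩
  · ext i q : 1
    change (w * up x) i q = F.J.subtype (∑ j, (BDKP.em w i j).fst (x j q))
    rw [map_sum, Matrix.mul_apply]
    rfl
  · ext i q : 1
    change (w.transpose * up x) i q = F.J.subtype (∑ j, (BDKP.em w j i).snd (x j q))
    rw [map_sum, Matrix.mul_apply]
    rfl

theorem Rep.derivation (δ : JDerivation F) :
    Rep p (sc F a (derOp δ)) δ.mat (fun x => -δ.mat x) :=
  ⟨fun x => by rw [act_sc]; rfl, fun x => by rw [actT_sc]; rfl⟩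

theorem Rep.opI : Rep p (opI F a) mInv (fun x => -mInv x) :=
  ⟨fun x => by rw [act_sc]; rfl, fun x => by rw [actT_sc]; rfl⟩

theorem Rep.intOp {m : ℕ} (g h : MatFun F a m) :
    Rep p (BDKP.em g * BDKP.opI F m * BDKP.em h.transpose) (intOp g h) (intOpT g h) := by
  refine (((Rep.em g).mul Rep.opI).mul (Rep.em h.transpose)).congr (fun x _ => ?_)
    (fun x _ => ?_)
  · rfl
  · rw [intOpT, Matrix.transpose_transpose, Matrix.mul_neg]

theorem Rep.opD_pow (j : ℕ) :
    Rep p (opD F a ^ j) mX^[j] (fun x => (-1 : ℂ) ^ j • mX^[j] x) := by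
  induction j with
  | zero =>
    rw [pow_zero]
    exact Rep.one.congr (fun x _ => rfl) (fun x _ => by rw [pow_zero, one_smul]; rfl)
  | succ j ih =>
    rw [pow_succ]
    refine (ih.mul (Rep.derivation (derX F))).congr (fun x _ => ?_) (fun x _ => ?_)
    · rw [Function.iterate_succ_apply, mX_eq]
    · rw [Function.iterate_succ_apply', ← mX_eq, mX_smul, pow_succ, mul_neg_one, neg_smul]

theorem Rep.diffR (k : ℕ) (u : ℕ → MatFun F a a) :
    Rep p (diffR k u) (diffOp k u) (diffOpT k u) :=
  Rep.sum _ fun j => (Rep.em (u j)).mul (Rep.opD_pow j)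

/-- Operators commute with multiplication by constant matrices from the right. -/
theorem Rep.mul_const {X : OpMat F a b} {f : MatFun F b p → MatFun F a p}
    {fT : MatFun F a p → MatFun F b p} {g : MatFun F b e → MatFun F a e}
    {gT : MatFun F a e → MatFun F b e} (h : Rep p X f fT) (h' : Rep e X g gT)
    (S : Matrix (Fin p) (Fin e) ℂ) {x : MatFun F b p} (hx : InJ x) :
    g (x * const F S) = f x * const F S := by
  obtain ⟨x, rfl⟩ := hx.exists_up
  rw [h.apply, up_mul_const, up_mul_const, h'.apply]
  congr 1
  ext i q : 1
  change ∑ j, (X i j).fst (∑ k, S k q • x j k) = ∑ k, S k q • ∑ j, (X i j).fst (x j k)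
  simp only [map_sum, map_smul, Finset.smul_sum]
  exact Finset.sum_comm

theorem Rep.mul_constT {X : OpMat F a b} {f : MatFun F b p → MatFun F a p}
    {fT : MatFun F a p → MatFun F b p} {g : MatFun F b e → MatFun F a e}
    {gT : MatFun F a e → MatFun F b e} (h : Rep p X f fT) (h' : Rep e X g gT)
    (S : Matrix (Fin p) (Fin e) ℂ) {x : MatFun F a p} (hx : InJ x) :
    gT (x * const F S) = fT x * const F S := by
  obtain ⟨x, rfl⟩ := hx.exists_up
  rw [h.applyT, up_mul_const, up_mul_const, h'.applyT]
  congr 1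
  ext j q : 1
  change ∑ i, (X i j).snd (∑ k, S k q • x i k) = ∑ k, S k q • ∑ i, (X i j).snd (x i k)
  simp only [map_sum, map_smul, Finset.smul_sum]
  exact Finset.sum_comm

theorem act_sub (X : OpMat F a b) (g h : Matrix (Fin b) (Fin p) F.J) :
    act X (g - h) = act X g - act X h := by
  ext i q : 1
  change ∑ j, (X i j).fst (g j q - h j q) =
    ∑ j, (X i j).fst (g j q) - ∑ j, (X i j).fst (h j q)
  simp only [map_sub, Finset.sum_sub_distrib]

theorem Rep.map_sub {X : OpMat F a b} {f : MatFun F b p → MatFun F a p}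
    {fT : MatFun F a p → MatFun F b p} (h : Rep p X f fT) {x y : MatFun F b p} (hx : InJ x)
    (hy : InJ y) : f (x - y) = f x - f y := by
  obtain ⟨x, rfl⟩ := hx.exists_up
  obtain ⟨y, rfl⟩ := hy.exists_up
  rw [show up x - up y = up (x - y) from rfl, h.apply, act_sub, h.apply, h.apply]
  rfl

end representation

/-! ### The operators $W$, $L$, $M$ as operator matrices. -/

section darboux

variable {Ω : TopologicalSpace.Opens Vars} {F : FunClass Ω} {N m K p : ℕ}
  (P : LaxData F N m) (B : DarbouxData F N K)

theorem rep_W : Rep p (WR B) B.W B.WT :=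
  Rep.one.sub (Rep.intOp (B.φ * B.Δ⁻¹) B.ψ)

theorem rep_Winv : Rep p (WiR B) B.Winv B.WinvT := by
  have h := Rep.one.add (Rep.intOp (p := p) B.φ (B.ψ * B.Δ⁻¹.transpose))
  rw [Matrix.transpose_mul, Matrix.transpose_transpose] at h
  exact h

theorem rep_conj {X : OpMat F N N} {f fT : MatFun F N p → MatFun F N p} (h : Rep p X f fT) :
    Rep p (WR B * X * WiR B) (B.conj f) (B.conjT fT) :=
  ((rep_W B).mul h).mul (rep_Winv B)

/-- The operator `L_k`. -/
def LR : OpMat F N N :=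
  sc F N (derOp ((derTau F).smul P.β)) - diffR P.k P.u
    - em (P.q * const F P.M0) * opI F m * em P.r.transpose

/-- The operator `M_{n,l}`. -/
def MR : OpMat F N N :=
  sc F N (derOp ((derT F).smul P.α)) - diffR P.n P.v
    - P.c • ∑ j ∈ Finset.range (P.l + 1),
        em (P.L^[j] P.q * const F P.M0) * opI F m * em (P.LT^[P.l - j] P.r).transpose

theorem rep_L : Rep p (LR P) P.L P.LT :=
  ((Rep.derivation ((derTau F).smul P.β)).sub (Rep.diffR P.k P.u)).sub (Rep.intOp _ _)

theorem rep_M : Rep p (MR P) P.M P.MT :=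
  ((Rep.derivation ((derT F).smul P.α)).sub (Rep.diffR P.n P.v)).sub
    ((Rep.sum _ fun _ => Rep.intOp _ _).smul P.c)

theorem Rep.iterate {X : OpMat F N N} {f fT : MatFun F N p → MatFun F N p} (h : Rep p X f fT)
    (j : ℕ) : Rep p (X ^ j) f^[j] fT^[j] := by
  induction j with
  | zero => rw [pow_zero]; exact Rep.one
  | succ j ih =>
    rw [pow_succ]
    refine (ih.mul h).congr (fun x _ => ?_) (fun x _ => ?_)
    · rw [Function.iterate_succ_apply]
    · rw [Function.iterate_succ_apply']

theorem rep_Mtilde : Rep p (MR P - P.c • LR P ^ (P.l + 1)) P.Mtilde P.MtildeT :=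
  (rep_M P).sub (((rep_L P).iterate (P.l + 1)).smul P.c)

theorem InJ_L_iterate {f : MatFun F N p} (hf : InJ f) (j : ℕ) : InJ (P.L^[j] f) :=
  ((rep_L P).iterate j).inJ hf

theorem InJ_LT_iterate {f : MatFun F N p} (hf : InJ f) (j : ℕ) : InJ (P.LT^[j] f) :=
  ((rep_L P).iterate j).inJT hf

variable {P B}

theorem W_Winv (hφ : InJ B.φ) (hΔ : IsUnit B.Δ) {f : MatFun F N p} (hf : InJ f) :
    B.W (B.Winv f) = f := by
  have h := (rep_W B (p := p)).mul (rep_Winv B)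
  rw [WR_mul_WiR hφ hΔ] at h
  exact h.unique Rep.one hf

theorem Winv_W (hφ : InJ B.φ) (hΔ : IsUnit B.Δ) {f : MatFun F N p} (hf : InJ f) :
    B.Winv (B.W f) = f := by
  have h := (rep_Winv B (p := p)).mul (rep_W B)
  rw [WiR_mul_WR hφ hΔ] at h
  exact h.unique Rep.one hf

/-- Transposition reverses products, so this is the transposed half of $W^{-1}W=1$. -/
theorem WT_WinvT (hφ : InJ B.φ) (hΔ : IsUnit B.Δ) {f : MatFun F N p} (hf : InJ f) :
    B.WT (B.WinvT f) = f := by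
  have h := (rep_Winv B (p := p)).mul (rep_W B)
  rw [WiR_mul_WR hφ hΔ] at h
  exact h.uniqueT Rep.one hf

theorem WinvT_WT (hφ : InJ B.φ) (hΔ : IsUnit B.Δ) {f : MatFun F N p} (hf : InJ f) :
    B.WinvT (B.WT f) = f := by
  have h := (rep_W B (p := p)).mul (rep_Winv B)
  rw [WR_mul_WiR hφ hΔ] at h
  exact h.uniqueT Rep.one hf

end darboux

/-! ### The form of the dressed operators. -/

section dressedOperators

variable {Ω : TopologicalSpace.Opens Vars} {F : FunClass Ω} {N m K p : ℕ}
  {P : LaxData F N m} {B : DarbouxData F N K}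

theorem const_mul_inv {C : Matrix (Fin K) (Fin K) ℂ} (hC : IsUnit C) :
    const F C * const F C⁻¹ = 1 := by
  rw [← const_mul, Matrix.mul_nonsing_inv _ ((Matrix.isUnit_iff_isUnit_det _).1 hC), const_one]

theorem mInv_eq_Δ_sub : mInv (B.ψ.transpose * B.φ) = B.Δ - const F B.C := by
  rw [DarbouxData.Δ, add_sub_cancel_left]

/-- Because $D^{-1}\{\psi^\top\varphi\}=\Delta-C$. -/
theorem W_φ (hΔ : IsUnit B.Δ) : B.W B.φ = B.φ * B.Δ⁻¹ * const F B.C := by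
  rw [DarbouxData.W, intOp, mInv_eq_Δ_sub, Matrix.mul_sub, Matrix.mul_assoc _ _ B.Δ,
    inv_mul_Δ hΔ, Matrix.mul_one, sub_sub_cancel]

theorem WinvT_ψ (hΔ : IsUnit B.Δ) :
    B.WinvT B.ψ = B.ψ * B.Δ⁻¹.transpose * const F B.C.transpose := by
  have h : B.φ.transpose * B.ψ = (B.ψ.transpose * B.φ).transpose := by
    rw [Matrix.transpose_mul, Matrix.transpose_transpose]
  rw [DarbouxData.WinvT, intOpT, h, mInv_transpose, mInv_eq_Δ_sub, Matrix.transpose_sub,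
    Matrix.mul_sub, Matrix.mul_assoc _ _ B.Δ.transpose, ← Matrix.transpose_mul, Δ_mul_inv hΔ,
    Matrix.transpose_one, Matrix.mul_one, const_transpose]
  abel

theorem Φ_eq (hΔ : IsUnit B.Δ) (hC : IsUnit B.C) : B.Φ = B.φ * B.Δ⁻¹ := by
  rw [DarbouxData.Φ, W_φ hΔ, Matrix.mul_assoc _ (const F B.C), const_mul_inv hC, Matrix.mul_one]

theorem Ψ_eq (hΔ : IsUnit B.Δ) (hC : IsUnit B.C) : B.Ψ = B.ψ * B.Δ⁻¹.transpose := by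
  rw [DarbouxData.Ψ, WinvT_ψ hΔ, Matrix.mul_assoc _ (const F B.C.transpose),
    const_mul_inv ((Matrix.isUnit_transpose B.C).2 hC), Matrix.mul_one]

theorem Ψ_transpose (hΔ : IsUnit B.Δ) (hC : IsUnit B.C) : B.Ψ.transpose = rowΨ B := by
  rw [Ψ_eq hΔ hC, Matrix.transpose_mul, Matrix.transpose_transpose, rowΨ]

theorem W_mul_const (S : Matrix (Fin p) (Fin m) ℂ) {f : MatFun F N p} (hf : InJ f) :
    B.W (f * const F S) = B.W f * const F S :=
  (rep_W B).mul_const (rep_W B) S hf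

/-- The inner factors $W^{-1}W$ cancel; this needs the iterates of $L$ to stay in $J$. -/
theorem Lhat_iterate_W (hφ : InJ B.φ) (hΔ : IsUnit B.Δ) {f : MatFun F N p} (hf : InJ f)
    (j : ℕ) : (Lhat P B)^[j] (B.W f) = B.W (P.L^[j] f) := by
  induction j with
  | zero => rfl
  | succ j ih =>
    rw [Function.iterate_succ_apply', ih, Function.iterate_succ_apply', Lhat, DarbouxData.conj,
      Winv_W hφ hΔ (InJ_L_iterate P hf j)]

theorem LhatT_iterate_WinvT (hφ : InJ B.φ) (hΔ : IsUnit B.Δ) {f : MatFun F N p} (hf : InJ f)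
    (j : ℕ) : (LhatT P B)^[j] (B.WinvT f) = B.WinvT (P.LT^[j] f) := by
  induction j with
  | zero => rfl
  | succ j ih =>
    rw [Function.iterate_succ_apply', ih, Function.iterate_succ_apply', LhatT, DarbouxData.conjT,
      WT_WinvT hφ hΔ (InJ_LT_iterate P hf j)]

variable {Λ Λ' : Matrix (Fin K) (Fin K) ℂ}

theorem L_iterate_φ (hφ : InJ B.φ) (hLφ : P.L B.φ = B.φ * const F Λ)
    (S : Matrix (Fin K) (Fin K) ℂ) (j : ℕ) :
    P.L^[j] (B.φ * const F S) = B.φ * const F (Λ ^ j * S) := by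
  induction j with
  | zero => rw [pow_zero, Matrix.one_mul]; rfl
  | succ j ih =>
    rw [Function.iterate_succ_apply', ih, (rep_L P).mul_const (rep_L P) _ hφ, hLφ,
      Matrix.mul_assoc, ← const_mul, ← Matrix.mul_assoc, ← pow_succ']

theorem LT_iterate_ψ (hψ : InJ B.ψ) (hLψ : P.LT B.ψ = B.ψ * const F Λ')
    (S : Matrix (Fin K) (Fin K) ℂ) (j : ℕ) :
    P.LT^[j] (B.ψ * const F S) = B.ψ * const F (Λ' ^ j * S) := by
  induction j with
  | zero => rw [pow_zero, Matrix.one_mul]; rfl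
  | succ j ih =>
    rw [Function.iterate_succ_apply', ih, (rep_L P).mul_constT (rep_L P) _ hψ, hLψ,
      Matrix.mul_assoc, ← const_mul, ← Matrix.mul_assoc, ← pow_succ']

theorem Φ_eq_W (hφ : InJ B.φ) : B.Φ = B.W (B.φ * const F B.C⁻¹) := (W_mul_const _ hφ).symm

theorem WinvT_mul_const (S : Matrix (Fin p) (Fin m) ℂ) {f : MatFun F N p} (hf : InJ f) :
    B.WinvT (f * const F S) = B.WinvT f * const F S :=
  (rep_Winv B).mul_constT (rep_Winv B) S hf

theorem Ψ_eq_WinvT (hψ : InJ B.ψ) : B.Ψ = B.WinvT (B.ψ * const F B.C.transpose⁻¹) :=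
  (WinvT_mul_const _ hψ).symm

/-- Because $\Phi=W\{\varphi C^{-1}\}$, iterating $\hat L$ only inserts powers of $\Lambda$ between
$C$ and $C^{-1}$. -/
theorem Lhat_iterate_Φ (hφ : InJ B.φ) (hΔ : IsUnit B.Δ)
    (hLφ : P.L B.φ = B.φ * const F Λ) (j : ℕ) :
    (Lhat P B)^[j] B.Φ = B.φ * B.Δ⁻¹ * const F (B.C * (Λ ^ j * B.C⁻¹)) := by
  rw [Φ_eq_W hφ, Lhat_iterate_W hφ hΔ (hφ.mul_right _), L_iterate_φ hφ hLφ, W_mul_const _ hφ,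
    W_φ hΔ, Matrix.mul_assoc _ (const F B.C), ← const_mul]

theorem LhatT_iterate_Ψ (hφ : InJ B.φ) (hψ : InJ B.ψ) (hΔ : IsUnit B.Δ)
    (hLψ : P.LT B.ψ = B.ψ * const F Λ') (j : ℕ) :
    ((LhatT P B)^[j] B.Ψ).transpose =
      const F (B.C⁻¹ * Λ'.transpose ^ j * B.C) * rowΨ B := by
  rw [Ψ_eq_WinvT hψ, LhatT_iterate_WinvT hφ hΔ (hψ.mul_right _), LT_iterate_ψ hψ hLψ,
    WinvT_mul_const _ hψ, WinvT_ψ hΔ, Matrix.mul_assoc _ (const F B.C.transpose), ← const_mul,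
    Matrix.transpose_mul, Matrix.transpose_mul, Matrix.transpose_transpose, ← const_transpose,
    Matrix.transpose_mul, Matrix.transpose_mul, Matrix.transpose_transpose, Matrix.transpose_pow,
    ← Matrix.transpose_nonsing_inv, Matrix.transpose_transpose, rowΨ]

theorem conj_L_eq (hφ : InJ B.φ) (hψ : InJ B.ψ) (hΔ : IsUnit B.Δ) (hq : InJ P.q)
    (hLφ : P.L B.φ = B.φ * const F Λ) (hLψ : P.LT B.ψ = B.ψ * const F Λ') :
    ∃ û : ℕ → MatFun F N N, WR B * LR P * WiR B =
      sc F N (derOp ((derTau F).smul P.β)) - diffR P.k û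
        - em (B.W (P.q * const F P.M0)) * opI F m * em (B.WinvT P.r).transpose
        + em (B.φ * B.Δ⁻¹ * const F (B.C * Λ - Λ'.transpose * B.C)) * opI F K *
          em (rowΨ B) := by
  obtain ⟨û, hû⟩ := Dresses.differential (B := B) hψ P.k P.u
  refine ⟨û, (((Dresses.derivation hφ hΔ _).sub hû).sub
    (Dresses.integral hφ (hq.mul_right _))).conj_eq hφ hΔ hLφ ?_⟩
  exact (congrArg Matrix.transpose hLψ).trans (Matrix.transpose_mul _ _)

/-- The dressings of the three kinds of terms, added up. With general $S,S'$ there is still a single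
new nonlocal term. -/
theorem conj_M_eq (hφ : InJ B.φ) (hψ : InJ B.ψ) (hΔ : IsUnit B.Δ) (hq : InJ P.q)
    {S S' : Matrix (Fin K) (Fin K) ℂ}
    (hMφ : P.M B.φ = B.φ * const F S) (hMψ : P.MT B.ψ = B.ψ * const F S') :
    ∃ v' : ℕ → MatFun F N N, WR B * MR P * WiR B =
      sc F N (derOp ((derT F).smul P.α)) - diffR P.n v'
        - P.c • ∑ j ∈ Finset.range (P.l + 1), em (B.W (P.L^[j] P.q * const F P.M0)) * opI F m *
            em (B.WinvT (P.LT^[P.l - j] P.r)).transpose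
        + em (B.φ * B.Δ⁻¹ * const F (B.C * S - S'.transpose * B.C)) * opI F K *
          em (rowΨ B) := by
  obtain ⟨v', hv'⟩ := Dresses.differential (B := B) hψ P.n P.v
  refine ⟨v', (((Dresses.derivation hφ hΔ _).sub hv').sub
    ((Dresses.sum fun j _ => Dresses.integral hφ
      ((InJ_L_iterate P hq j).mul_right _)).smul P.c)).conj_eq hφ hΔ hMφ ?_⟩
  rw [← Matrix.transpose_sum, ← Matrix.transpose_smul]
  exact (congrArg Matrix.transpose hMψ).trans (Matrix.transpose_mul _ _)

theorem Lhat_form (hφ : InJ B.φ) (hψ : InJ B.ψ) (hΔ : IsUnit B.Δ) (hC : IsUnit B.C)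
    (hq : InJ P.q) (hLφ : P.L B.φ = B.φ * const F Λ) (hLψ : P.LT B.ψ = B.ψ * const F Λ') :
    ∃ û : ℕ → MatFun F N N, ∀ (p : ℕ) (f : MatFun F N p), InJ f →
      Lhat P B f = LhatForm P B Λ Λ' û f ∧ LhatT P B f = LhatFormT P B Λ Λ' û f := by
  obtain ⟨û, h⟩ := conj_L_eq hφ hψ hΔ hq hLφ hLψ
  refine ⟨û, fun p f hf => ?_⟩
  have h1 := rep_conj B (rep_L P (p := p))
  rw [h, W_mul_const _ hq, ← Ψ_transpose hΔ hC, ← Φ_eq hΔ hC] at h1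
  have h2 : Rep p _ (LhatForm P B Λ Λ' û) (LhatFormT P B Λ Λ' û) :=
    (((Rep.derivation ((derTau F).smul P.β)).sub (Rep.diffR P.k û)).sub
      (Rep.intOp (qhat P B * const F P.M0) (rhat P B))).add
        (Rep.intOp (B.Φ * const F (M1 B Λ Λ')) B.Ψ)
  exact ⟨h1.unique h2 hf, h1.uniqueT h2 hf⟩

/-- The summand is $a_{s+1}-a_s$ for $a_s=CX^sC^{-1}Y^{l+1-s}C$. -/
theorem sum_telescope {C : Matrix (Fin K) (Fin K) ℂ} (hC : IsUnit C)
    (X Y : Matrix (Fin K) (Fin K) ℂ) (l : ℕ) :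
    ∑ s ∈ Finset.range (l + 1),
        C * (X ^ s * C⁻¹) * (C * X - Y * C) * (C⁻¹ * Y ^ (l - s) * C) =
      C * X ^ (l + 1) - Y ^ (l + 1) * C := by
  have hdet := (Matrix.isUnit_iff_isUnit_det _).1 hC
  have h (s : ℕ) (hs : s ∈ Finset.range (l + 1)) :
      C * (X ^ s * C⁻¹) * (C * X - Y * C) * (C⁻¹ * Y ^ (l - s) * C) =
        C * (X ^ (s + 1) * C⁻¹ * Y ^ (l + 1 - (s + 1))) * C
          - C * (X ^ s * C⁻¹ * Y ^ (l + 1 - s)) * C := by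
    -- The truncated subtraction satisfies $l+1-s=(l-s)+1$ because $s\le l$.
    rw [Nat.succ_sub (Nat.lt_succ_iff.1 (Finset.mem_range.1 hs)), Nat.add_sub_add_right, pow_succ,
      pow_succ']
    simp only [mul_sub, sub_mul, mul_assoc, Matrix.nonsing_inv_mul_cancel_left _ _ hdet,
      Matrix.mul_nonsing_inv_cancel_left _ _ hdet]
  rw [Finset.sum_congr rfl h,
    Finset.sum_range_sub fun s => C * (X ^ s * C⁻¹ * Y ^ (l + 1 - s)) * C]
  simp only [Nat.sub_self, Nat.sub_zero, pow_zero, mul_one, one_mul, mul_assoc,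
    Matrix.nonsing_inv_mul _ hdet, Matrix.mul_nonsing_inv_cancel_left _ _ hdet]

theorem const_smul (z : ℂ) (S : Matrix (Fin p) (Fin m) ℂ) : const F (z • S) = z • const F S := by
  ext i j : 1
  change algebraMap ℂ F.carrier (z * S i j) = z • algebraMap ℂ F.carrier (S i j)
  rw [map_mul, Algebra.smul_def]

theorem const_sum {ι : Type*} (s : Finset ι) (S : ι → Matrix (Fin p) (Fin m) ℂ) :
    const F (∑ i ∈ s, S i) = ∑ i ∈ s, const F (S i) := by
  ext i j : 1
  simp only [const, Matrix.map_apply, Matrix.sum_apply, map_sum]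

theorem em_mul_const_mul_opI (g : MatFun F N K) (h : MatFun F K N)
    (X Y Z : Matrix (Fin K) (Fin K) ℂ) :
    em (g * const F X * const F Y) * opI F K * em (const F Z * h) =
      em (g * const F (X * Y * Z)) * opI F K * em h := by
  have hZ : em (const F Z) * opI F K = opI F K * em (const F Z) := (opI_mul_const Z).symm
  rw [const_mul, const_mul, ← Matrix.mul_assoc, ← Matrix.mul_assoc, em_mul _ (const F Z),
    Matrix.mul_assoc _ (em (const F Z)), hZ, em_mul _ h]
  simp only [Matrix.mul_assoc]

/-- The telescoping sum with $X=\Lambda$, $Y=\tilde\Lambda^\top$, whose outer factors belong to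
$\Phi[s]$ and $\Psi[l-s]^\top$ since constants pass through $D^{-1}$. -/
theorem nonlocal_term (hφ : InJ B.φ) (hψ : InJ B.ψ) (hΔ : IsUnit B.Δ) (hC : IsUnit B.C)
    (hLφ : P.L B.φ = B.φ * const F Λ) (hLψ : P.LT B.ψ = B.ψ * const F Λ') :
    em (B.φ * B.Δ⁻¹ * const F (B.C * (P.c • Λ ^ (P.l + 1))
        - (P.c • Λ' ^ (P.l + 1)).transpose * B.C)) * opI F K * em (rowΨ B) =
      P.c • ∑ s ∈ Finset.range (P.l + 1), em ((Lhat P B)^[s] B.Φ * const F (M1 B Λ Λ')) *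
        opI F K * em ((LhatT P B)^[P.l - s] B.Ψ).transpose := by
  have hS : B.C * (P.c • Λ ^ (P.l + 1)) - (P.c • Λ' ^ (P.l + 1)).transpose * B.C =
      P.c • ∑ s ∈ Finset.range (P.l + 1), B.C * (Λ ^ s * B.C⁻¹) *
        (B.C * Λ - Λ'.transpose * B.C) * (B.C⁻¹ * Λ'.transpose ^ (P.l - s) * B.C) := by
    rw [sum_telescope hC, smul_sub, Matrix.mul_smul, Matrix.transpose_smul, Matrix.smul_mul,
      Matrix.transpose_pow]
  have hs (s : ℕ) : em ((Lhat P B)^[s] B.Φ * const F (M1 B Λ Λ')) * opI F K *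
      em ((LhatT P B)^[P.l - s] B.Ψ).transpose =
      em (B.φ * B.Δ⁻¹ * const F (B.C * (Λ ^ s * B.C⁻¹) * M1 B Λ Λ' *
        (B.C⁻¹ * Λ'.transpose ^ (P.l - s) * B.C))) * opI F K * em (rowΨ B) := by
    rw [Lhat_iterate_Φ hφ hΔ hLφ, LhatT_iterate_Ψ hφ hψ hΔ hLψ]
    exact em_mul_const_mul_opI _ _ _ _ _
  rw [hS, const_smul, const_sum, Matrix.mul_smul, em_smul, Matrix.smul_mul, Matrix.smul_mul,
    Matrix.mul_sum, em_sum, Matrix.sum_mul, Matrix.sum_mul]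
  exact congrArg (P.c • ·) (Finset.sum_congr rfl fun s _ => (hs s).symm)

theorem Mhat_form (hφ : InJ B.φ) (hψ : InJ B.ψ) (hΔ : IsUnit B.Δ) (hC : IsUnit B.C)
    (hq : InJ P.q) (hr : InJ P.r)
    (hLφ : P.L B.φ = B.φ * const F Λ) (hLψ : P.LT B.ψ = B.ψ * const F Λ')
    (hMφ : P.M B.φ = P.c • (B.φ * const F (Λ ^ (P.l + 1))))
    (hMψ : P.MT B.ψ = P.c • (B.ψ * const F (Λ' ^ (P.l + 1)))) :
    ∃ v' : ℕ → MatFun F N N, ∀ (p : ℕ) (f : MatFun F N p), InJ f →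
      Mhat P B f = MhatForm P B Λ Λ' v' f ∧ MhatT P B f = MhatFormT P B Λ Λ' v' f := by
  -- The factor $c$ is absorbed into the eigenvalue matrices.
  rw [← Matrix.mul_smul, ← const_smul] at hMφ hMψ
  obtain ⟨v', h⟩ := conj_M_eq hφ hψ hΔ hq hMφ hMψ
  refine ⟨v', fun p f hf => ?_⟩
  have h1 := rep_conj B (rep_M P (p := p))
  have h2 : Rep p _ (MhatForm P B Λ Λ' v') (MhatFormT P B Λ Λ' v') :=
    (((Rep.derivation ((derT F).smul P.α)).sub (Rep.diffR P.n v')).sub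
      ((Rep.sum (Finset.range (P.l + 1)) fun j =>
        Rep.intOp ((Lhat P B)^[j] (qhat P B) * const F P.M0)
          ((LhatT P B)^[P.l - j] (rhat P B))).smul P.c)).add
      ((Rep.sum (Finset.range (P.l + 1)) fun s =>
        Rep.intOp ((Lhat P B)^[s] B.Φ * const F (M1 B Λ Λ'))
          ((LhatT P B)^[P.l - s] B.Ψ)).smul P.c)
  have hq' (j : ℕ) : B.W (P.L^[j] P.q * const F P.M0) =
      (Lhat P B)^[j] (qhat P B) * const F P.M0 := by
    rw [W_mul_const _ (InJ_L_iterate P hq j), qhat, Lhat_iterate_W hφ hΔ hq]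
  have hr' (j : ℕ) : B.WinvT (P.LT^[j] P.r) = (LhatT P B)^[j] (rhat P B) := by
    rw [rhat, LhatT_iterate_WinvT hφ hΔ hr]
  simp only [h, hq', hr', nonlocal_term hφ hψ hΔ hC hLφ hLψ] at h1
  exact ⟨h1.unique h2 hf, h1.uniqueT h2 hf⟩

end dressedOperators

/-! ### The operator $\hat{\tilde M}$: equations for $\Phi$, $\Psi$ and the Lax equation. -/

section dressedOperators

variable {Ω : TopologicalSpace.Opens Vars} {F : FunClass Ω} {N m K p : ℕ}
  {P : LaxData F N m} {B : DarbouxData F N K} {Λ Λ' : Matrix (Fin K) (Fin K) ℂ}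

theorem Lhat_iterate (hφ : InJ B.φ) (hΔ : IsUnit B.Δ) {f : MatFun F N p} (hf : InJ f) (j : ℕ) :
    (Lhat P B)^[j] f = B.W (P.L^[j] (B.Winv f)) := by
  rw [← Lhat_iterate_W hφ hΔ ((rep_Winv B).inJ hf), W_Winv hφ hΔ hf]

theorem LhatT_iterate (hφ : InJ B.φ) (hΔ : IsUnit B.Δ) {f : MatFun F N p} (hf : InJ f) (j : ℕ) :
    (LhatT P B)^[j] f = B.WinvT (P.LT^[j] (B.WT f)) := by
  rw [← LhatT_iterate_WinvT hφ hΔ ((rep_W B).inJT hf), WinvT_WT hφ hΔ hf]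

theorem MtildeHat_eq (hφ : InJ B.φ) (hΔ : IsUnit B.Δ) {f : MatFun F N p} (hf : InJ f) :
    MtildeHat P B f = Mhat P B f - P.c • (Lhat P B)^[P.l + 1] f := by
  have h := rep_conj B (rep_Mtilde P (p := p))
  rw [Matrix.mul_sub, Matrix.sub_mul, Matrix.mul_smul, Matrix.smul_mul] at h
  rw [Lhat_iterate hφ hΔ hf]
  exact h.unique ((rep_conj B (rep_M P)).sub
    ((rep_conj B ((rep_L P).iterate (P.l + 1))).smul P.c)) hf

theorem MtildeHatT_eq (hφ : InJ B.φ) (hΔ : IsUnit B.Δ) {f : MatFun F N p} (hf : InJ f) :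
    MtildeHatT P B f = MhatT P B f - P.c • (LhatT P B)^[P.l + 1] f := by
  have h := rep_conj B (rep_Mtilde P (p := p))
  rw [Matrix.mul_sub, Matrix.sub_mul, Matrix.mul_smul, Matrix.smul_mul] at h
  rw [LhatT_iterate hφ hΔ hf]
  exact h.uniqueT ((rep_conj B (rep_M P)).sub
    ((rep_conj B ((rep_L P).iterate (P.l + 1))).smul P.c)) hf

theorem Mtilde_φ (hφ : InJ B.φ) (hLφ : P.L B.φ = B.φ * const F Λ)
    (hMφ : P.M B.φ = P.c • (B.φ * const F (Λ ^ (P.l + 1)))) : P.Mtilde B.φ = 0 := by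
  have h := L_iterate_φ hφ hLφ 1 (P.l + 1)
  rw [const_one, Matrix.mul_one, Matrix.mul_one] at h
  rw [LaxData.Mtilde, hMφ, h, sub_self]

theorem MtildeT_ψ (hψ : InJ B.ψ) (hLψ : P.LT B.ψ = B.ψ * const F Λ')
    (hMψ : P.MT B.ψ = P.c • (B.ψ * const F (Λ' ^ (P.l + 1)))) : P.MtildeT B.ψ = 0 := by
  have h := LT_iterate_ψ hψ hLψ 1 (P.l + 1)
  rw [const_one, Matrix.mul_one, Matrix.mul_one] at h
  rw [LaxData.MtildeT, hMψ, h, sub_self]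

theorem MtildeHat_Φ (hφ : InJ B.φ) (hΔ : IsUnit B.Δ) (h : P.Mtilde B.φ = 0) :
    MtildeHat P B B.Φ = 0 := by
  rw [Φ_eq_W hφ, MtildeHat, DarbouxData.conj, Winv_W hφ hΔ (hφ.mul_right _),
    (rep_Mtilde P).mul_const (rep_Mtilde P) _ hφ, h, Matrix.zero_mul]
  have h0 := (rep_W B).map_sub (InJ.zero (F := F) (a := N) (b := K)) InJ.zero
  rwa [sub_self, sub_self] at h0

theorem MtildeHatT_Ψ (hφ : InJ B.φ) (hψ : InJ B.ψ) (hΔ : IsUnit B.Δ) (h : P.MtildeT B.ψ = 0) :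
    MtildeHatT P B B.Ψ = 0 := by
  rw [Ψ_eq_WinvT hψ, MtildeHatT, DarbouxData.conjT, WT_WinvT hφ hΔ (hψ.mul_right _),
    (rep_Mtilde P).mul_constT (rep_Mtilde P) _ hψ, h, Matrix.zero_mul, DarbouxData.WinvT, intOpT,
    Matrix.mul_zero, zero_add]
  -- $D^{-1}$ is given by a choice of preimage, so $D^{-1}\{0\}=0$ rests on injectivity of $D$ on
  -- $J$.
  have h0 : mInv (0 : MatFun F K K) = 0 :=
    mX_inj InJ.zero.mInv InJ.zero (by rw [mX_mInv InJ.zero, mX_zero])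
  rw [h0, Matrix.mul_zero, neg_zero]

/-- $L$ commutes with its own power $L^{l+1}$, so subtracting $cL^{l+1}$ from $M$ keeps the
commutation. -/
theorem L_Mtilde_comm
    (h : ∀ (p : ℕ) (f : MatFun F N p), InJ f → P.L (P.M f) = P.M (P.L f)) {f : MatFun F N p}
    (hf : InJ f) : P.L (P.Mtilde f) = P.Mtilde (P.L f) := by
  have h1 := (rep_L P (p := p)).map_sub ((rep_M P).inJ hf)
    ((InJ_L_iterate P hf (P.l + 1)).smul P.c)
  have h2 : P.L (P.c • P.L^[P.l + 1] f) = P.c • P.L (P.L^[P.l + 1] f) := by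
    have hs := ((rep_L P (p := p)).mul (Rep.one.smul P.c))
    rw [Matrix.mul_smul, Matrix.mul_one] at hs
    exact hs.unique ((rep_L P).smul P.c) (InJ_L_iterate P hf (P.l + 1))
  rw [LaxData.Mtilde, h1, h p f hf, h2, LaxData.Mtilde, ← Function.iterate_succ_apply' P.L,
    Function.iterate_succ_apply]

theorem Lhat_MtildeHat_comm (hφ : InJ B.φ) (hΔ : IsUnit B.Δ)
    (h : ∀ (p : ℕ) (f : MatFun F N p), InJ f → P.L (P.M f) = P.M (P.L f)) {f : MatFun F N p}
    (hf : InJ f) : Lhat P B (MtildeHat P B f) = MtildeHat P B (Lhat P B f) := by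
  have hg := (rep_Winv B).inJ hf
  change B.W (P.L (B.Winv (B.W (P.Mtilde (B.Winv f))))) =
    B.W (P.Mtilde (B.Winv (B.W (P.L (B.Winv f)))))
  rw [Winv_W hφ hΔ ((rep_Mtilde P).inJ hg), Winv_W hφ hΔ ((rep_L P).inJ hg), L_Mtilde_comm h hg]

end dressedOperators

end operatorCalculus

end BDKP

end

theorem mainTheorem6 {Ω : TopologicalSpace.Opens Vars} (F : FunClass Ω) {N m K : ℕ}
    (P : LaxData F N m) (B : DarbouxData F N K) (Λ Λ' : Matrix (Fin K) (Fin K) ℂ)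
    (hq : InJ P.q) (hr : InJ P.r) (hφ : InJ B.φ) (hψ : InJ B.ψ)
    (hC : IsUnit B.C) (hΔ : IsUnit B.Δ)
    (hLφ : P.L B.φ = B.φ * const F Λ)
    (hLψ : P.LT B.ψ = B.ψ * const F Λ')
    (hMφ : P.M B.φ = P.c • (B.φ * const F (Λ ^ (P.l + 1))))
    (hMψ : P.MT B.ψ = P.c • (B.ψ * const F (Λ' ^ (P.l + 1)))) :
    -- `Winv` and `WinvT` are the inverses of `W` and `WT`
    (∀ (p : ℕ) (f : MatFun F N p), InJ f →
      B.W (B.Winv f) = f ∧ B.Winv (B.W f) = f ∧ B.WT (B.WinvT f) = f ∧ B.WinvT (B.WT f) = f) ∧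
    -- the closed forms of the dressed functions
    (InJ B.Φ ∧ InJ B.Ψ ∧ B.Φ = B.φ * B.Δ⁻¹ ∧ B.Ψ = B.ψ * B.Δ⁻¹.transpose) ∧
    -- the form of the dressed operators
    (∃ û : ℕ → MatFun F N N, ∀ (p : ℕ) (f : MatFun F N p), InJ f →
      Lhat P B f = LhatForm P B Λ Λ' û f ∧ LhatT P B f = LhatFormT P B Λ Λ' û f) ∧
    (∃ v' : ℕ → MatFun F N N, ∀ (p : ℕ) (f : MatFun F N p), InJ f →
      Mhat P B f = MhatForm P B Λ Λ' v' f ∧ MhatT P B f = MhatFormT P B Λ Λ' v' f) ∧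
    (∀ (p : ℕ) (f : MatFun F N p), InJ f →
      MtildeHat P B f = Mhat P B f - P.c • (Lhat P B)^[P.l + 1] f ∧
      MtildeHatT P B f = MhatT P B f - P.c • (LhatT P B)^[P.l + 1] f) ∧
    -- the equations for the dressed functions
    (MtildeHat P B B.Φ = 0 ∧ Mhat P B B.Φ - P.c • (Lhat P B)^[P.l + 1] B.Φ = 0) ∧
    (MtildeHatT P B B.Ψ = 0 ∧ MhatT P B B.Ψ - P.c • (LhatT P B)^[P.l + 1] B.Ψ = 0) ∧
    -- the Lax equation is preserved
    ((∀ (p : ℕ) (f : MatFun F N p), InJ f → P.L (P.M f) = P.M (P.L f)) →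
      ∀ (p : ℕ) (f : MatFun F N p), InJ f →
        Lhat P B (MtildeHat P B f) = MtildeHat P B (Lhat P B f)) := by
  have hΦ := Φ_eq hΔ hC
  have hΨ := Ψ_eq hΔ hC
  have hΦJ : InJ B.Φ := hΦ ▸ hφ.mul_right _
  have hΨJ : InJ B.Ψ := hΨ ▸ hψ.mul_right _
  have hM := MtildeHat_Φ hφ hΔ (Mtilde_φ hφ hLφ hMφ)
  have hMT := MtildeHatT_Ψ hφ hψ hΔ (MtildeT_ψ hψ hLψ hMψ)
  exact ⟨fun p f hf => ⟨W_Winv hφ hΔ hf, Winv_W hφ hΔ hf, WT_WinvT hφ hΔ hf, WinvT_WT hφ hΔ hf⟩,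
    ⟨hΦJ, hΨJ, hΦ, hΨ⟩,
    Lhat_form hφ hψ hΔ hC hq hLφ hLψ,
    Mhat_form hφ hψ hΔ hC hq hr hLφ hLψ hMφ hMψ,
    fun p f hf => ⟨MtildeHat_eq hφ hΔ hf, MtildeHatT_eq hφ hΔ hf⟩,
    ⟨hM, (MtildeHat_eq hφ hΔ hΦJ).symm.trans hM⟩,
    ⟨hMT, (MtildeHatT_eq hφ hΔ hΨJ).symm.trans hMT⟩,
    fun h p f hf => Lhat_MtildeHat_comm hφ hΔ h hf⟩
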